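/- **Theorem.** Let $k$ be any field (of any characteristic, $\mathbb F_2,\mathbb F_3,\mathbb F_5$ included). Then the quadratic hyperfield $Q(k)$ is a hyperfield, the pierced powerset $\mathcal P^*(Q(k))$ is a quadratically presentable field, and there is an isomorphism of rings $$\omega: W(k)\longrightarrow W(\mathcal P^*(Q(k))),\qquad \overline{\langle a_1,\dots,a_n\rangle}\longmapsto\overline{\langle\{\bar a_1\},\dots,\{\bar a_n\}\rangle}\quad(a_1,\dots,a_n\in k^*),$$ where $W(k)$ is the classical Witt ring of non-degenerate symmetric bilinear forms over $k$. The notions are as follows. *Classical Witt ring.* $W(k)$ consists of the classes of non-degenerate symmetric bilinear forms on finite-dimensional $k$-vector spaces, where $X\sim Y$ iff $X\perp M\cong Y\perp N$ for some metabolic $M,N$ (a form is metabolic if some subspace $L$ satisfies $L=L^\perp$); sum and product are induced by $\perp$ and $\otimes$. $\langle a_1,\dots,a_n\rangle$ is the form $\sum_i a_ix_iy_i$ on $k^n$. *Quadratic hyperfield.* A hyperfield is a set with an addition whose values are non-empty subsets, commutative, associative, with $a+0=\{a\}$, with an inversion $-$ such that $0\in a+(-a)$ and $a\in b+c\Rightarrow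 c\in a+(-b)$, and with a commutative monoid multiplication such that $0a=0$, $a(b+c)=ab+ac$, $0\neq1$ and every $a\ne0$ is invertible. Let $k/_mk^{*2}$ be the quotient of $k$ by $x\sim y\iff xs=yt$ for some $s,t\in k^{*2}$, with the induced product and $-$, and with $\bar x\in\bar y+\bar z$ iff $xs=yt+zu$ for some $s,t,u\in k^{*2}$. $Q(k)$ is $k/_mk^{*2}$ with the same product and $-$ and with the modified addition $+'$: $\bar y+'\bar z=\bar y+\bar z$ if $\bar y=\bar 0$ or $\bar z=\bar 0$; $\bar y+'\bar z=(\bar y+\bar z)\cup\{\bar y,\bar z\}$ if $\bar y,\bar z\neq\bar 0$ and $\bar y\ne-\bar z$; $\bar y+'\bar z=k/_mk^{*2}$ if $\bar y=-\bar z\neq\bar0$. *Pierced powerset.* $\mathcal P^*(F)$ is the set of non-empty subsets of $F$, ordered by inclusion, with $0=\{0\}$, $1=\{1\}$, $A+B=\bigcup_{a\in A,b\in B}(a+b)$, $-A=\{-a\mid a\in A\}$, $AB=\{ab\mid a\in A,b\in B\}$. *Presentable fields.* For a poset $A$ let $\mathcal S_A$ be its set of minimal elements (supercompacts) and $\mathcal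 S_a$ the set of those below $a$. A poset with a base point $p$ is presentable if every non-empty subset of $\mathcal S_A$ has a supremum, $x=\bigvee\mathcal S_x$ for all $x$, $p$ is minimal, and every minimal element $s$ is compact ($s\le\bigvee Y$, $Y\neq\varnothing$, implies $s\le y$ for some $y\in Y$). A presentable field $R$ is a presentable poset $(R,\le,0)$ with a commutative and associative addition with neutral element $0$ that preserves suprema of non-empty sets in each argument; an involution $-$ preserving suprema of non-empty sets with $s\le t+u\Rightarrow t\le s+(-u)$ for $s,t,u\in\mathcal S_R$; and a monotone, associative, commutative multiplication with unit $1$ such that $(-a)b=-(ab)$, $s(b+c)=sb+sc$ for $s\in\mathcal S_R$, $b,c\in R$, $\mathcal S_{ab}=\{st\mid s\in\mathcal S_a,t\in\mathcal S_b\}$, and $\mathcal S_R^*=\mathcal S_R\setminus\{0\}$ is a group under multiplication with identity $1$. It is pre-quadratically presentable if moreover (i) $a\le a+b$ for $a\in\mathcal S_R^*$, $b\in\mathcal S_R$; (ii) $a\le1-b$ and $a\le1-c$ imply $a\le1-bc$ for $a,b,c\in\mathcal S_R$; (iii) $a^2=1$ for $a\in\mathcal S_R^*$. *Forms.* A form over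 $R$ is a finite tuple $\langle a_1,\dots,a_n\rangle$ in $\mathcal S_R^*$. Isometry of forms of the same dimension is defined by: $\langle a\rangle\cong\langle b\rangle$ iff $a=b$; $\langle a_1,a_2\rangle\cong\langle b_1,b_2\rangle$ iff $a_1a_2=b_1b_2$ and $b_1\le a_1+a_2$; and, for $n\geq3$, $\langle a_1,\dots,a_n\rangle\cong\langle b_1,\dots,b_n\rangle$ iff there are $x,y,c_3,\dots,c_n\in\mathcal S_R^*$ with $\langle a_1,x\rangle\cong\langle b_1,y\rangle$, $\langle a_2,\dots,a_n\rangle\cong\langle x,c_3,\dots,c_n\rangle$ and $\langle b_2,\dots,b_n\rangle\cong\langle y,c_3,\dots,c_n\rangle$. $R$ is quadratically presentable if it is pre-quadratically presentable and $\cong$ is an equivalence relation in every dimension. In that case $W(R)$ is the ring of classes of forms under Witt equivalence, $\phi\sim\psi$ iff $\phi\oplus m\times\langle1,-1\rangle\cong\psi\oplus n\times\langle1,-1\rangle$ for some $m,n\geq0$, with sum and product induced by concatenation $\oplus$ and by $\langle a_i\rangle_i\otimes\langle b_j\rangle_j=\langle a_ib_j\rangle_{i,j}$. -/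

import Mathlib

universe u

set_option linter.unusedSectionVars false

namespace PresentableWitt

/-! ### Presentable posets -/

section Posets

variable {A : Type u} [PartialOrder A]

/-- The set of minimal elements below `a`. -/
def minimalsBelow (a : A) : Set A := {s | IsMin s ∧ s ≤ a}

/-- Compactness with respect to arbitrary (not only directed) non-empty suprema. -/
def IsCompactPoint (x : A) : Prop :=
  ∀ (Y : Set A) (b : A), Y.Nonempty → IsLUB Y b → x ≤ b → ∃ y ∈ Y, x ≤ y

/-- Weakly presentable posets. -/
structure IsWeaklyPresentable (A : Type u) [PartialOrder A] : Prop where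
  exists_isLUB : ∀ S : Set A, S.Nonempty → (∀ s ∈ S, IsMin s) → ∃ x, IsLUB S x
  isLUB_minimalsBelow : ∀ x : A, IsLUB (minimalsBelow x) x

/-- Presentable pointed posets, with base point `p`. The minimal elements of a presentable poset
are called its supercompacts. -/
structure IsPresentable (A : Type u) [PartialOrder A] (p : A) : Prop
    extends IsWeaklyPresentable A where
  isMin_basepoint : IsMin p
  isCompactPoint : ∀ a : A, IsMin a → IsCompactPoint a

end Posets

/-! ### Presentable monoids, groups, rings and fields -/

/-- Presentable monoids. -/
structure IsPresentableMonoid (M : Type u) [PartialOrder M] [Zero M] [Add M] : Prop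
    extends IsPresentable M 0 where
  /-- Addition preserves suprema of non-empty sets in both arguments. -/
  isLUB_add : ∀ (X Y : Set M) (a b : M), X.Nonempty → Y.Nonempty → IsLUB X a → IsLUB Y b →
    IsLUB (Set.image2 (· + ·) X Y) (a + b)
  add_assoc : ∀ a b c : M, a + (b + c) = (a + b) + c
  add_zero : ∀ a : M, a + 0 = a
  zero_add : ∀ a : M, 0 + a = a
  add_comm : ∀ a b : M, a + b = b + a

/-- Presentable groups. -/
structure IsPresentableGroup (G : Type u) [PartialOrder G] [Zero G] [Add G] [Neg G] : Prop
    extends IsPresentableMonoid G where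
  neg_neg : ∀ a : G, - -a = a
  isLUB_neg : ∀ (X : Set G) (a : G), X.Nonempty → IsLUB X a → IsLUB ((fun x => -x) '' X) (-a)
  exchange : ∀ s t u : G, IsMin s → IsMin t → IsMin u → s ≤ t + u → t ≤ s + -u

/-- Presentable rings. Multiplication by supercompacts is distributive; for arbitrary `a` this
gives only `a * (b + c) ≤ a * b + a * c`, as is the case for pierced powersets. -/
structure IsPresentableRing (R : Type u) [PartialOrder R] [Zero R] [Add R] [Neg R] [Mul R] [One R] :
    Prop extends IsPresentableGroup R where
  mul_assoc : ∀ a b c : R, a * (b * c) = (a * b) * c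
  mul_comm : ∀ a b : R, a * b = b * a
  one_mul : ∀ a : R, 1 * a = a
  mul_le_mul_left : ∀ a b c : R, a ≤ b → c * a ≤ c * b
  neg_mul : ∀ a b : R, -a * b = -(a * b)
  left_distrib : ∀ s b c : R, IsMin s → s * (b + c) = s * b + s * c
  minimalsBelow_mul : ∀ a b : R,
    minimalsBelow (a * b) = Set.image2 (· * ·) (minimalsBelow a) (minimalsBelow b)

/-- Presentable fields: presentable rings whose non-zero supercompacts form a group under
multiplication, with identity `1`. -/
structure IsPresentableField (R : Type u) [PartialOrder R] [Zero R] [Add R] [Neg R] [Mul R]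
    [One R] : Prop extends IsPresentableRing R where
  isMin_one : IsMin (1 : R)
  one_ne_zero : (1 : R) ≠ 0
  mul_ne_zero : ∀ a b : R, IsMin a → IsMin b → a ≠ 0 → b ≠ 0 → a * b ≠ 0
  exists_inv : ∀ a : R, IsMin a → a ≠ 0 → ∃ b : R, IsMin b ∧ b ≠ 0 ∧ a * b = 1

/-- Pre-quadratically presentable fields. -/
structure IsPreQuadraticallyPresentable (R : Type u) [PartialOrder R] [Zero R] [Add R] [Neg R]
    [Mul R] [One R] : Prop extends IsPresentableField R where
  le_add : ∀ a b : R, IsMin a → a ≠ 0 → IsMin b → a ≤ a + b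
  le_one_sub_mul : ∀ a b c : R, IsMin a → IsMin b → IsMin c →
    a ≤ 1 + -b → a ≤ 1 + -c → a ≤ 1 + -(b * c)
  mul_self : ∀ a : R, IsMin a → a ≠ 0 → a * a = 1

/-! ### Forms, isometry, quadratically presentable fields -/

/-- The non-zero supercompacts of `R`. -/
def NonzeroSupercompact (R : Type u) [PartialOrder R] [Zero R] : Type u :=
  {a : R // IsMin a ∧ a ≠ 0}

/-- A form `⟨a₁, …, aₙ⟩` is a tuple of non-zero supercompacts (the empty tuple is allowed). -/
abbrev Form (R : Type u) [PartialOrder R] [Zero R] : Type u := List (NonzeroSupercompact R)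

/-- Isometry of forms, defined by induction on the (common) dimension. -/
inductive FormIsometry {R : Type u} [PartialOrder R] [Zero R] [Add R] [Mul R] :
    Form R → Form R → Prop
  | nil : FormIsometry [] []
  | unary (a : NonzeroSupercompact R) : FormIsometry [a] [a]
  | binary (a₁ a₂ b₁ b₂ : NonzeroSupercompact R) (disc : a₁.1 * a₂.1 = b₁.1 * b₂.1)
      (le : b₁.1 ≤ a₁.1 + a₂.1) : FormIsometry [a₁, a₂] [b₁, b₂]
  /-- Dimension `n ≥ 3`, where `c = (c₃, …, cₙ)` is non-empty. -/
  | step (a₁ b₁ x y : NonzeroSupercompact R) (a b c : Form R) (hc : c ≠ [])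
      (h₁ : FormIsometry [a₁, x] [b₁, y]) (h₂ : FormIsometry a (x :: c))
      (h₃ : FormIsometry b (y :: c)) : FormIsometry (a₁ :: a) (b₁ :: b)

/-- Quadratically presentable fields. Isometric forms have the same dimension, so isometry is an
equivalence relation on all forms if and only if it is one in every dimension. -/
class IsQuadraticallyPresentable (R : Type u) [PartialOrder R] [Zero R] [Add R] [Neg R]
    [Mul R] [One R] : Prop extends IsPreQuadraticallyPresentable R where
  equivalence_formIsometry : Equivalence (FormIsometry (R := R))

/-! ### The Witt ring of a quadratically presentable field -/

section WittRing

variable {R : Type u} [PartialOrder R] [Zero R] [Add R] [Neg R] [Mul R] [One R]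

theorem IsPresentableRing.isMin_mul (h : IsPresentableRing R) {a b : R} (ha : IsMin a)
    (hb : IsMin b) : IsMin (a * b) := by
  have : a * b ∈ minimalsBelow (a * b) := by
    rw [h.minimalsBelow_mul]
    exact ⟨a, ⟨ha, le_rfl⟩, b, ⟨hb, le_rfl⟩, rfl⟩
  exact this.1

theorem IsPresentableGroup.neg_mono (h : IsPresentableGroup R) {a b : R} (hab : a ≤ b) :
    -a ≤ -b := by
  have h1 : IsLUB {a, b} b := ⟨by rintro x (rfl | rfl) <;> simp [hab], fun y hy => hy (by simp)⟩
  exact (h.isLUB_neg _ _ ⟨a, by simp⟩ h1).1 ⟨a, by simp, rfl⟩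

theorem IsPresentableGroup.isMin_neg (h : IsPresentableGroup R) {a : R} (ha : IsMin a) :
    IsMin (-a) := by
  intro b hb
  have h1 := h.neg_mono hb
  rw [h.neg_neg] at h1
  have h2 := h.neg_mono (ha h1)
  rwa [h.neg_neg] at h2

theorem IsPresentableGroup.neg_zero (h : IsPresentableGroup R) : -(0 : R) = 0 := by
  have h0 := h.isMin_basepoint
  have h1 := h.exchange 0 0 0 h0 h0 h0 (by rw [h.add_zero])
  rw [h.zero_add] at h1
  exact ((h.isMin_neg h0).eq_of_le h1).symm

theorem IsPresentableGroup.neg_ne_zero (h : IsPresentableGroup R) {a : R} (ha : a ≠ 0) :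
    -a ≠ 0 := fun h1 => ha (by rw [← h.neg_neg a, h1, h.neg_zero])

namespace NonzeroSupercompact

variable [hR : IsQuadraticallyPresentable R]

instance : CommMonoid (NonzeroSupercompact R) where
  mul a b := ⟨a.1 * b.1, hR.isMin_mul a.2.1 b.2.1, hR.mul_ne_zero _ _ a.2.1 b.2.1 a.2.2 b.2.2⟩
  one := ⟨1, hR.isMin_one, hR.one_ne_zero⟩
  mul_assoc a b c := Subtype.ext (hR.mul_assoc a.1 b.1 c.1).symm
  mul_comm a b := Subtype.ext (hR.mul_comm a.1 b.1)
  one_mul a := Subtype.ext (hR.one_mul a.1)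
  mul_one a := Subtype.ext ((hR.mul_comm a.1 1).trans (hR.one_mul a.1))

instance : HasDistribNeg (NonzeroSupercompact R) where
  neg a := ⟨-a.1, hR.isMin_neg a.2.1, hR.neg_ne_zero a.2.2⟩
  neg_neg a := Subtype.ext (hR.neg_neg a.1)
  neg_mul a b := Subtype.ext (hR.neg_mul a.1 b.1)
  mul_neg a b := Subtype.ext ((hR.mul_comm a.1 (-b.1)).trans
    ((hR.neg_mul b.1 a.1).trans (congrArg _ (hR.mul_comm b.1 a.1))))

theorem mul_self (a : NonzeroSupercompact R) : a * a = 1 := Subtype.ext (hR.mul_self a.1 a.2.1 a.2.2)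

theorem val_mul (a b : NonzeroSupercompact R) : (a * b).1 = a.1 * b.1 := rfl

end NonzeroSupercompact

namespace Form

/-- The orthogonal sum `⟨a₁, …, aₙ, b₁, …, bₘ⟩`. -/
def oplus (φ ψ : Form R) : Form R := φ ++ ψ

variable [hR : IsQuadraticallyPresentable R]

/-- The tensor product `⟨a₁b₁, …, a₁bₘ, a₂b₁, …, aₙbₘ⟩`. -/
def tensor (φ ψ : Form R) : Form R := φ.flatMap fun a => ψ.map fun b => a * b

/-- The form `n × ⟨1, -1⟩`. -/
def hyperbolic (n : ℕ) : Form R := (List.replicate n [1, -1]).flatten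

/-- Witt equivalence of forms. -/
def WittEquiv (φ ψ : Form R) : Prop :=
  ∃ m n : ℕ, FormIsometry (oplus φ (hyperbolic m)) (oplus ψ (hyperbolic n))

theorem iso_refl (φ : Form R) : FormIsometry φ φ := hR.equivalence_formIsometry.refl φ

theorem iso_symm {φ ψ : Form R} (h : FormIsometry φ ψ) : FormIsometry ψ φ :=
  hR.equivalence_formIsometry.symm h

theorem iso_trans {φ ψ χ : Form R} (h : FormIsometry φ ψ) (h' : FormIsometry ψ χ) :
    FormIsometry φ χ := hR.equivalence_formIsometry.trans h h'

theorem iso_length {φ ψ : Form R} (h : FormIsometry φ ψ) : φ.length = ψ.length := by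
  induction h with
  | nil => rfl
  | unary => rfl
  | binary => rfl
  | step a₁ b₁ x y a b c hc h₁ h₂ h₃ _ h₂' h₃' => simp_all

theorem iso_cons (a : NonzeroSupercompact R) {φ ψ : Form R} (h : FormIsometry φ ψ) :
    FormIsometry (a :: φ) (a :: ψ) := by
  rcases ψ with _ | ⟨x, _ | ⟨y, c⟩⟩
  · rw [List.eq_nil_of_length_eq_zero (iso_length h)]
    exact iso_refl _
  · have : φ = [x] := by
      cases h with
      | unary => rfl
      | step a₁ b₁ x y a b c hc h₁ h₂ h₃ => simpa using iso_length h₃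
    rw [this]
    exact iso_refl _
  · exact .step a a x x φ (x :: y :: c) (y :: c) (by simp) (iso_refl _) h (iso_refl _)

theorem iso_binary_append {a b c d : NonzeroSupercompact R} (h : FormIsometry [a, b] [c, d])
    (φ : Form R) : FormIsometry (a :: b :: φ) (c :: d :: φ) := by
  rcases φ with _ | ⟨x, φ⟩
  · exact h
  · exact .step a c b d _ _ _ (by simp) h (iso_refl _) (iso_refl _)

theorem iso_swap (a b : NonzeroSupercompact R) : FormIsometry [a, b] [b, a] :=
  .binary _ _ _ _ (hR.mul_comm _ _)
    (by rw [hR.add_comm]; exact hR.le_add _ _ b.2.1 b.2.2 a.2.1)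

theorem iso_of_perm {φ ψ : Form R} (h : φ.Perm ψ) : FormIsometry φ ψ := by
  induction h with
  | nil => exact .nil
  | cons a _ ih => exact iso_cons a ih
  | swap a b φ => exact iso_binary_append (iso_swap b a) φ
  | trans _ _ h₁ h₂ => exact iso_trans h₁ h₂

theorem iso_append_left (χ : Form R) {φ ψ : Form R} (h : FormIsometry φ ψ) :
    FormIsometry (χ ++ φ) (χ ++ ψ) := by
  induction χ with
  | nil => exact h
  | cons a χ ih => exact iso_cons a ih

theorem iso_append {φ φ' ψ ψ' : Form R} (h : FormIsometry φ φ') (h' : FormIsometry ψ ψ') :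
    FormIsometry (φ ++ ψ) (φ' ++ ψ') :=
  iso_trans (iso_append_left φ h') <| iso_trans (iso_of_perm List.perm_append_comm) <|
    iso_trans (iso_append_left ψ' h) (iso_of_perm List.perm_append_comm)

theorem iso_map_mul (c : NonzeroSupercompact R) {φ ψ : Form R} (h : FormIsometry φ ψ) :
    FormIsometry (φ.map (c * ·)) (ψ.map (c * ·)) := by
  induction h with
  | nil => exact .nil
  | unary a => exact .unary _
  | binary a₁ a₂ b₁ b₂ disc le =>
    refine .binary _ _ _ _ ?_ ?_
    · have h : a₁ * a₂ = b₁ * b₂ := Subtype.ext disc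
      have : c * a₁ * (c * a₂) = c * b₁ * (c * b₂) := by
        rw [mul_mul_mul_comm, h, mul_mul_mul_comm]
      exact congrArg Subtype.val this
    · have := hR.mul_le_mul_left _ _ c.1 le
      rwa [hR.left_distrib _ _ _ c.2.1] at this
  | step a₁ b₁ x y a b d hd h₁ h₂ h₃ h₁' h₂' h₃' =>
    exact .step _ _ (c * x) (c * y) _ _ (d.map (c * ·)) (by simpa using hd) h₁' h₂' h₃'

theorem coe_tensor (φ ψ : Form R) :
    ((tensor φ ψ : Form R) : Multiset (NonzeroSupercompact R)) =
      (φ : Multiset _).bind fun a => (ψ : Multiset _).map fun b => a * b := by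
  simp [tensor]

theorem tensor_perm_comm (φ ψ : Form R) : (tensor φ ψ).Perm (tensor ψ φ) := by
  rw [← Multiset.coe_eq_coe, coe_tensor, coe_tensor, Multiset.bind_map_comm]
  simp only [mul_comm]

theorem iso_tensor_left (χ : Form R) {φ ψ : Form R} (h : FormIsometry φ ψ) :
    FormIsometry (tensor χ φ) (tensor χ ψ) := by
  induction χ with
  | nil => exact .nil
  | cons a χ ih => exact iso_append (iso_map_mul a h) ih

theorem tensor_append_perm (χ φ ψ : Form R) :
    (tensor χ (φ ++ ψ)).Perm (tensor χ φ ++ tensor χ ψ) := by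
  rw [← Multiset.coe_eq_coe, ← Multiset.coe_add, coe_tensor, coe_tensor, coe_tensor,
    ← Multiset.coe_add]
  simp only [Multiset.map_add, Multiset.bind_add]

theorem iso_neg_self (a : NonzeroSupercompact R) : FormIsometry [a, -a] [1, -1] := by
  refine .binary _ _ _ _ ?_ ?_
  · have : a * -a = 1 * -1 := by rw [mul_neg, a.mul_self, one_mul]
    exact congrArg Subtype.val this
  · have h1 : (1 : R) ≤ a.1 + -a.1 := by
      refine hR.exchange _ _ _ a.2.1 hR.isMin_one a.2.1 ?_
      rw [hR.add_comm]
      exact hR.le_add _ _ a.2.1 a.2.2 hR.isMin_one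
    exact h1

theorem hyperbolic_succ (n : ℕ) :
    (hyperbolic (n + 1) : Form R) = 1 :: -1 :: hyperbolic n := by
  simp [hyperbolic, List.replicate_succ]

theorem hyperbolic_add (m n : ℕ) :
    (hyperbolic (m + n) : Form R) = hyperbolic m ++ hyperbolic n := by
  rw [hyperbolic, List.replicate_add, List.flatten_append, hyperbolic, hyperbolic]

theorem iso_append_neg (φ : Form R) :
    FormIsometry (φ ++ φ.map fun a => -a) (hyperbolic φ.length) := by
  induction φ with
  | nil => exact .nil
  | cons a φ ih =>
    have h1 : (a :: φ ++ (a :: φ).map fun a => -a).Perm (a :: -a :: (φ ++ φ.map fun a => -a)) := by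
      simp
    rw [List.length_cons, hyperbolic_succ]
    exact iso_trans (iso_of_perm h1) (iso_trans (iso_binary_append (iso_neg_self a) _)
      (iso_cons _ (iso_cons _ ih)))

theorem iso_tensor_hyperbolic (φ : Form R) (n : ℕ) :
    FormIsometry (tensor φ (hyperbolic n)) (hyperbolic (n * φ.length)) := by
  induction n with
  | zero =>
    have : tensor φ (hyperbolic 0) = [] := by simp [tensor, hyperbolic]
    rw [this, Nat.zero_mul]
    exact .nil
  | succ n ih =>
    have h1 : (tensor φ [1, -1]).Perm (φ ++ φ.map fun a => -a) := by
      refine (tensor_perm_comm _ _).trans (List.Perm.of_eq ?_)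
      simp [tensor]
    rw [hyperbolic_succ, Nat.succ_mul, Nat.add_comm, hyperbolic_add]
    exact iso_trans (iso_of_perm (tensor_append_perm φ [1, -1] (hyperbolic n)))
      (iso_append (iso_trans (iso_of_perm h1) (iso_append_neg φ)) ih)

theorem WittEquiv.of_iso {φ ψ : Form R} (h : FormIsometry φ ψ) : WittEquiv φ ψ :=
  ⟨0, 0, iso_append h (iso_refl _)⟩

theorem WittEquiv.of_perm {φ ψ : Form R} (h : φ.Perm ψ) : WittEquiv φ ψ := .of_iso (iso_of_perm h)

theorem WittEquiv.symm {φ ψ : Form R} : WittEquiv φ ψ → WittEquiv ψ φ :=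
  fun ⟨m, n, h⟩ => ⟨n, m, iso_symm h⟩

theorem WittEquiv.trans {φ ψ χ : Form R} : WittEquiv φ ψ → WittEquiv ψ χ → WittEquiv φ χ := by
  rintro ⟨m, n, h⟩ ⟨m', n', h'⟩
  refine ⟨m + m', n' + n, ?_⟩
  have h1 := iso_append h (iso_refl (hyperbolic m'))
  have h2 := iso_append h' (iso_refl (hyperbolic n))
  simp only [oplus, List.append_assoc, ← hyperbolic_add] at h1 h2 ⊢
  rw [Nat.add_comm n m'] at h1
  exact iso_trans h1 h2

theorem WittEquiv.append_left (χ : Form R) {φ ψ : Form R} :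
    WittEquiv φ ψ → WittEquiv (χ ++ φ) (χ ++ ψ) := by
  rintro ⟨m, n, h⟩
  refine ⟨m, n, ?_⟩
  have := iso_append_left χ h
  simpa only [oplus, List.append_assoc] using this

theorem WittEquiv.append {φ φ' ψ ψ' : Form R} (h : WittEquiv φ φ') (h' : WittEquiv ψ ψ') :
    WittEquiv (φ ++ ψ) (φ' ++ ψ') :=
  (h'.append_left φ).trans <| (of_perm List.perm_append_comm).trans <|
    (h.append_left ψ').trans (of_perm List.perm_append_comm)

theorem WittEquiv.tensor_left (χ : Form R) {φ ψ : Form R} :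
    WittEquiv φ ψ → WittEquiv (tensor χ φ) (tensor χ ψ) := by
  rintro ⟨m, n, h⟩
  refine ⟨m * χ.length, n * χ.length, ?_⟩
  have key : ∀ (φ : Form R) (m : ℕ), FormIsometry (tensor χ (φ ++ hyperbolic m))
      (tensor χ φ ++ hyperbolic (m * χ.length)) := fun φ m =>
    iso_trans (iso_of_perm (tensor_append_perm _ _ _))
      (iso_append_left _ (iso_tensor_hyperbolic χ m))
  exact iso_trans (iso_symm (key φ m)) (iso_trans (iso_tensor_left χ h) (key ψ n))

theorem WittEquiv.tensor {φ φ' ψ ψ' : Form R} (h : WittEquiv φ φ') (h' : WittEquiv ψ ψ') :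
    WittEquiv (tensor φ ψ) (tensor φ' ψ') :=
  (h'.tensor_left φ).trans <| (of_perm (tensor_perm_comm _ _)).trans <|
    (h.tensor_left ψ').trans (of_perm (tensor_perm_comm _ _))

theorem WittEquiv.map_neg {φ ψ : Form R} (h : WittEquiv φ ψ) :
    WittEquiv (φ.map fun a => -a) (ψ.map fun a => -a) := by
  have := h.tensor_left [-1]
  simpa [Form.tensor] using this

theorem WittEquiv.append_neg (φ : Form R) : WittEquiv (φ ++ φ.map fun a => -a) [] :=
  ⟨0, φ.length, by simpa [oplus, hyperbolic] using iso_append_neg φ⟩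

variable (R) in
/-- Witt equivalence as a setoid. -/
def wittSetoid : Setoid (Form R) where
  r := WittEquiv
  iseqv := ⟨fun φ => .of_iso (iso_refl φ), .symm, .trans⟩

end Form

variable (R) in
/-- The Witt ring of a quadratically presentable field: Witt equivalence classes of forms, with
addition induced by the orthogonal sum and multiplication induced by the tensor product. -/
def WittRing [IsQuadraticallyPresentable R] : Type u := Quotient (Form.wittSetoid R)

namespace WittRing

open Form

variable [hR : IsQuadraticallyPresentable R]

/-- The Witt equivalence class of a form. -/
def mk (φ : Form R) : WittRing R := Quotient.mk (wittSetoid R) φ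

theorem mk_eq_mk_iff {φ ψ : Form R} : mk φ = mk ψ ↔ WittEquiv φ ψ := Quotient.eq

theorem mk_of_perm {φ ψ : Form R} (h : φ.Perm ψ) : mk φ = mk ψ := mk_eq_mk_iff.2 (.of_perm h)

theorem ind {P : WittRing R → Prop} (h : ∀ φ, P (mk φ)) (x : WittRing R) : P x := Quotient.ind h x

instance : Zero (WittRing R) := ⟨mk []⟩
instance : One (WittRing R) := ⟨mk [1]⟩
instance : Add (WittRing R) :=
  ⟨Quotient.map₂ oplus fun _ _ h _ _ h' => WittEquiv.append h h'⟩
instance : Mul (WittRing R) :=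
  ⟨Quotient.map₂ tensor fun _ _ h _ _ h' => WittEquiv.tensor h h'⟩
instance : Neg (WittRing R) :=
  ⟨Quotient.map (fun φ => φ.map fun a => -a) fun _ _ h => WittEquiv.map_neg h⟩

theorem mk_add (φ ψ : Form R) : mk φ + mk ψ = mk (oplus φ ψ) := rfl
theorem mk_mul (φ ψ : Form R) : mk φ * mk ψ = mk (tensor φ ψ) := rfl
theorem mk_neg (φ : Form R) : -mk φ = mk (φ.map fun a => -a) := rfl
theorem mk_nil : mk ([] : Form R) = 0 := rfl
theorem mk_one : mk ([1] : Form R) = 1 := rfl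

/-- The zero of the Witt ring is the class of `⟨1, -1⟩`. -/
theorem mk_one_neg_one : mk ([1, -1] : Form R) = 0 :=
  mk_eq_mk_iff.2 (WittEquiv.append_neg [1])

theorem add_comm' (x y : WittRing R) : x + y = y + x := by
  induction x using ind; induction y using ind
  exact mk_of_perm List.perm_append_comm

theorem mul_comm' (x y : WittRing R) : x * y = y * x := by
  induction x using ind; induction y using ind
  exact mk_of_perm (tensor_perm_comm _ _)

theorem mul_add' (x y z : WittRing R) : x * (y + z) = x * y + x * z := by
  induction x using ind; induction y using ind; induction z using ind
  exact mk_of_perm (tensor_append_perm _ _ _)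

instance : CommRing (WittRing R) where
  add_assoc x y z := by
    induction x using ind; induction y using ind; induction z using ind
    simp only [mk_add, oplus, List.append_assoc]
  zero_add x := by induction x using ind; rfl
  add_zero x := by rw [add_comm']; induction x using ind; rfl
  add_comm := add_comm'
  nsmul := nsmulRec
  zsmul := zsmulRec
  left_distrib := mul_add'
  right_distrib x y z := by simp only [mul_comm' _ z, mul_add']
  zero_mul x := by induction x using ind; rfl
  mul_zero x := by rw [mul_comm']; induction x using ind; rfl
  mul_assoc x y z := by
    induction x using ind; induction y using ind; induction z using ind
    refine mk_of_perm ?_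
    rw [← Multiset.coe_eq_coe]
    simp only [coe_tensor, Multiset.bind_assoc, Multiset.bind_map, Multiset.map_bind,
      Multiset.map_map, Function.comp_def, mul_assoc]
  one_mul x := by
    induction x using ind
    rw [← mk_one, mk_mul]
    simp [tensor]
  mul_one x := by
    rw [mul_comm']
    induction x using ind
    rw [← mk_one, mk_mul]
    simp [tensor]
  neg_add_cancel x := by
    rw [add_comm']
    induction x using ind
    exact mk_eq_mk_iff.2 (WittEquiv.append_neg _)
  mul_comm := mul_comm'

end WittRing

end WittRing

/-! ### Hyperfields -/

/-- The pierced powerset: the set of non-empty subsets of `X`, ordered by inclusion. -/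
def PiercedPowerset (X : Type u) : Type u := {A : Set X // A.Nonempty}

instance (X : Type u) : PartialOrder (PiercedPowerset X) :=
  inferInstanceAs (PartialOrder {A : Set X // A.Nonempty})

/-- The singleton `{x}` as an element of the pierced powerset. -/
def PiercedPowerset.singleton {X : Type u} (x : X) : PiercedPowerset X :=
  ⟨{x}, Set.singleton_nonempty x⟩

/-- A multivalued addition on `F`. -/
class HyperAdd (F : Type u) where
  hadd : F → F → PiercedPowerset F

/-- The sum `a + b` in a multivalued addition, as a set. -/
def hsum {F : Type u} [HyperAdd F] (a b : F) : Set F := (HyperAdd.hadd a b).1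

theorem hsum_nonempty {F : Type u} [HyperAdd F] (a b : F) : (hsum a b).Nonempty :=
  (HyperAdd.hadd a b).2

/-- Hyperfields. -/
structure IsHyperfield (F : Type u) [Zero F] [One F] [Neg F] [Mul F] [HyperAdd F] : Prop where
  hsum_zero : ∀ a : F, hsum a 0 = {a}
  zero_hsum : ∀ a : F, hsum 0 a = {a}
  hsum_comm : ∀ a b : F, hsum a b = hsum b a
  hsum_assoc : ∀ a b c : F, ⋃ x ∈ hsum a b, hsum x c = ⋃ x ∈ hsum b c, hsum a x
  zero_mem_hsum_neg : ∀ a : F, 0 ∈ hsum a (-a)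
  exchange : ∀ a b c : F, a ∈ hsum b c → c ∈ hsum a (-b)
  mul_assoc : ∀ a b c : F, a * b * c = a * (b * c)
  mul_comm : ∀ a b : F, a * b = b * a
  one_mul : ∀ a : F, 1 * a = a
  zero_mul : ∀ a : F, 0 * a = 0
  mul_hsum : ∀ a b c : F, (fun x => a * x) '' hsum b c = hsum (a * b) (a * c)
  zero_ne_one : (0 : F) ≠ 1
  exists_inv : ∀ a : F, a ≠ 0 → ∃ b : F, a * b = 1

namespace PiercedPowerset

variable {F : Type u}

instance [Zero F] : Zero (PiercedPowerset F) := ⟨singleton 0⟩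

instance [One F] : One (PiercedPowerset F) := ⟨singleton 1⟩

instance [HyperAdd F] : Add (PiercedPowerset F) :=
  ⟨fun A B => ⟨⋃ a ∈ A.1, ⋃ b ∈ B.1, hsum a b, by
    obtain ⟨a, ha⟩ := A.2
    obtain ⟨b, hb⟩ := B.2
    obtain ⟨c, hc⟩ := hsum_nonempty a b
    exact ⟨c, Set.mem_biUnion ha (Set.mem_biUnion hb hc)⟩⟩⟩

instance [Neg F] : Neg (PiercedPowerset F) := ⟨fun A => ⟨(fun a => -a) '' A.1, A.2.image _⟩⟩

instance [Mul F] : Mul (PiercedPowerset F) :=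
  ⟨fun A B => ⟨Set.image2 (fun a b => a * b) A.1 B.1, A.2.image2 B.2⟩⟩

theorem isMin_singleton (x : F) : IsMin (singleton x) := by
  rintro ⟨B, b, hb⟩ hB
  have hB' : B ⊆ {x} := hB
  have : b = x := hB' hb
  subst this
  exact Set.singleton_subset_iff.2 hb

theorem singleton_ne_zero [Zero F] {x : F} (hx : x ≠ 0) : singleton x ≠ 0 := fun h =>
  hx (Set.singleton_injective (congrArg Subtype.val h))

end PiercedPowerset

/-! ### The quotient hyperfield of a field and the quadratic hyperfield -/

section Quotient

variable {k : Type u} [Field k]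

/-- The relation `x ∼ y ↔ x s = y t` for some `s, t ∈ T`. -/
def mulSetoid (T : Subgroup kˣ) : Setoid k where
  r x y := ∃ s ∈ T, ∃ t ∈ T, x * (s : k) = y * (t : k)
  iseqv :=
    { refl := fun x => ⟨1, T.one_mem, 1, T.one_mem, rfl⟩
      symm := fun ⟨s, hs, t, ht, h⟩ => ⟨t, ht, s, hs, h.symm⟩
      trans := by
        rintro x y z ⟨s, hs, t, ht, h⟩ ⟨s', hs', t', ht', h'⟩
        refine ⟨s * s', T.mul_mem hs hs', t' * t, T.mul_mem ht' ht, ?_⟩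
        push_cast
        linear_combination (s' : k) * h + (t : k) * h' }

/-- The quotient hyperfield `k /ₘ T` of a field `k` modulo a subgroup `T` of `kˣ`. -/
def MulQuotient (T : Subgroup kˣ) : Type u := Quotient (mulSetoid T)

namespace MulQuotient

variable (T : Subgroup kˣ)

/-- The class of `x` in `k /ₘ T`. -/
def mk (x : k) : MulQuotient T := Quotient.mk (mulSetoid T) x

theorem mk_eq_mk_iff {x y : k} :
    mk T x = mk T y ↔ ∃ s ∈ T, ∃ t ∈ T, x * (s : k) = y * (t : k) := Quotient.eq

instance : Zero (MulQuotient T) := ⟨mk T 0⟩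

instance : One (MulQuotient T) := ⟨mk T 1⟩

instance : Neg (MulQuotient T) :=
  ⟨Quotient.map (fun x => -x) (by
    rintro x y ⟨s, hs, t, ht, h⟩
    exact ⟨s, hs, t, ht, by linear_combination -h⟩)⟩

instance : Mul (MulQuotient T) :=
  ⟨Quotient.map₂ (fun x y => x * y) (by
    rintro x y ⟨s, hs, t, ht, h⟩ x' y' ⟨s', hs', t', ht', h'⟩
    refine ⟨s * s', T.mul_mem hs hs', t * t', T.mul_mem ht ht', ?_⟩
    push_cast
    linear_combination (x' * s' : k) * h + (y * t : k) * h')⟩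

/-- `p ∈ q + r` if and only if `x = y + z` for some representatives `x, y, z` of `p, q, r`. -/
instance : HyperAdd (MulQuotient T) where
  hadd q r := ⟨{p | ∃ x y z : k, mk T x = p ∧ mk T y = q ∧ mk T z = r ∧ x = y + z}, by
    induction q using Quotient.ind
    induction r using Quotient.ind
    exact ⟨_, _, _, _, rfl, rfl, rfl, rfl⟩⟩

/-- The hyperaddition in terms of fixed representatives. -/
theorem mk_mem_hsum_iff (x y z : k) :
    mk T x ∈ hsum (mk T y) (mk T z) ↔
      ∃ s ∈ T, ∃ t ∈ T, ∃ u ∈ T, x * (s : k) = y * (t : k) + z * (u : k) := by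
  constructor
  · rintro ⟨x', y', z', hx, hy, hz, h⟩
    obtain ⟨s, hs, s', hs', hx⟩ := (mk_eq_mk_iff T).1 hx
    obtain ⟨t, ht, t', ht', hy⟩ := (mk_eq_mk_iff T).1 hy
    obtain ⟨u, hu, u', hu', hz⟩ := (mk_eq_mk_iff T).1 hz
    refine ⟨s' * t * u, T.mul_mem (T.mul_mem hs' ht) hu, t' * s * u,
      T.mul_mem (T.mul_mem ht' hs) hu, u' * s * t, T.mul_mem (T.mul_mem hu' hs) ht, ?_⟩
    push_cast
    linear_combination (-t * u : k) * hx + (s * u : k) * hy + (s * t : k) * hz +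
      (s * t * u : k) * h
  · rintro ⟨s, hs, t, ht, u, hu, h⟩
    exact ⟨x * s, y * t, z * u, (mk_eq_mk_iff T).2 ⟨1, T.one_mem, s, hs, by simp⟩,
      (mk_eq_mk_iff T).2 ⟨1, T.one_mem, t, ht, by simp⟩,
      (mk_eq_mk_iff T).2 ⟨1, T.one_mem, u, hu, by simp⟩, h⟩

theorem mk_ne_zero (a : kˣ) : mk T (a : k) ≠ 0 := by
  intro h
  obtain ⟨s, _, t, _, h⟩ := (mk_eq_mk_iff T).1 h
  rw [zero_mul, ← Units.val_mul] at h
  exact (a * s).ne_zero h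

end MulQuotient

end Quotient

open Classical in
/-- The modified addition: `a +' b = a + b` if `a = 0` or `b = 0`; `a +' b` is everything if
`a = -b ≠ 0`; and `a +' b = (a + b) ∪ {a, b}` otherwise. -/
noncomputable def modifiedHadd {F : Type u} [Zero F] [Neg F] [HyperAdd F] (a b : F) :
    PiercedPowerset F :=
  if a = 0 ∨ b = 0 then HyperAdd.hadd a b
  else if a = -b then ⟨Set.univ, a, trivial⟩
  else ⟨hsum a b ∪ {a, b}, (hsum_nonempty a b).inl⟩

/-- The quadratic hyperfield `Q(k)` of a field `k`: the quotient `k /ₘ k*²` by the group of non-zero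
squares, with the modified addition. -/
def QuadraticHyperfield (k : Type u) [Field k] : Type u := MulQuotient (Subgroup.square kˣ)

namespace QuadraticHyperfield

variable (k : Type u) [Field k]

instance : Zero (QuadraticHyperfield k) :=
  inferInstanceAs (Zero (MulQuotient (Subgroup.square kˣ)))

instance : One (QuadraticHyperfield k) :=
  inferInstanceAs (One (MulQuotient (Subgroup.square kˣ)))

instance : Neg (QuadraticHyperfield k) :=
  inferInstanceAs (Neg (MulQuotient (Subgroup.square kˣ)))

instance : Mul (QuadraticHyperfield k) :=
  inferInstanceAs (Mul (MulQuotient (Subgroup.square kˣ)))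

noncomputable instance : HyperAdd (QuadraticHyperfield k) where
  hadd := modifiedHadd (F := MulQuotient (Subgroup.square kˣ))

variable {k}

/-- The class of `x` in `Q(k)`. -/
def mk (x : k) : QuadraticHyperfield k := MulQuotient.mk (Subgroup.square kˣ) x

/-- The non-zero supercompact `{ā}` of the pierced powerset of `Q(k)`, for `a ∈ kˣ`. -/
def supercompact (a : kˣ) : NonzeroSupercompact (PiercedPowerset (QuadraticHyperfield k)) :=
  ⟨PiercedPowerset.singleton (mk (a : k)), PiercedPowerset.isMin_singleton _,
    PiercedPowerset.singleton_ne_zero (MulQuotient.mk_ne_zero _ a)⟩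

end QuadraticHyperfield

/-! ### The classical Witt ring of non-degenerate symmetric bilinear forms -/

open scoped TensorProduct

open LinearMap (BilinForm)

section Forms

variable {k : Type u} [Field k]
variable {V : Type u} [AddCommGroup V] [Module k V] {V' : Type u} [AddCommGroup V'] [Module k V']
variable {W : Type u} [AddCommGroup W] [Module k W] {W' : Type u} [AddCommGroup W'] [Module k W']
variable {U : Type u} [AddCommGroup U] [Module k U]

/-- The orthogonal sum of bilinear forms, `(v, w), (v', w') ↦ B v v' + C w w'`. -/
def prodForm (B : BilinForm k V) (C : BilinForm k W) : BilinForm k (V × W) :=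
  B.compl₁₂ (LinearMap.fst k V W) (LinearMap.fst k V W) +
    C.compl₁₂ (LinearMap.snd k V W) (LinearMap.snd k V W)

/-- The tensor product of bilinear forms, `(v ⊗ w, v' ⊗ w') ↦ B v v' * C w w'`. -/
noncomputable def tensorForm (B : BilinForm k V) (C : BilinForm k W) : BilinForm k (V ⊗[k] W) :=
  BilinForm.tmul B C

/-- A bilinear form is metabolic if some subspace equals its own orthogonal complement. -/
def IsMetabolicForm (B : BilinForm k V) : Prop := ∃ L : Submodule k V, B.orthogonal L = L

theorem prodForm_apply (B : BilinForm k V) (C : BilinForm k W) (x y : V × W) :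
    prodForm B C x y = B x.1 y.1 + C x.2 y.2 := rfl

theorem tensorForm_tmul (B : BilinForm k V) (C : BilinForm k W) (v v' : V) (w w' : W) :
    tensorForm B C (v ⊗ₜ w) (v' ⊗ₜ w') = B v v' * C w w' := mul_comm _ _

theorem mem_orthogonal (B : BilinForm k V) (L : Submodule k V) (y : V) :
    y ∈ B.orthogonal L ↔ ∀ x ∈ L, B x y = 0 := Iff.rfl

theorem nondegenerate_of_left {B : BilinForm k V} (hB : B.IsSymm)
    (h : ∀ x, (∀ y, B x y = 0) → x = 0) : B.Nondegenerate :=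
  ⟨h, fun y hy => h y fun x => by rw [hB.eq y x]; exact hy x⟩

theorem isSymm_prodForm {B : BilinForm k V} {C : BilinForm k W} (hB : B.IsSymm) (hC : C.IsSymm) :
    (prodForm B C).IsSymm :=
  ⟨fun x y => by rw [prodForm_apply, prodForm_apply, hB.eq, hC.eq]⟩

theorem nondegenerate_prodForm {B : BilinForm k V} {C : BilinForm k W} (hB : B.IsSymm)
    (hC : C.IsSymm) (hB' : B.Nondegenerate) (hC' : C.Nondegenerate) :
    (prodForm B C).Nondegenerate :=
  nondegenerate_of_left (isSymm_prodForm hB hC) fun x h =>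
    Prod.ext (hB'.1 _ fun y => by simpa [prodForm_apply] using h (y, 0))
      (hC'.1 _ fun y => by simpa [prodForm_apply] using h (0, y))

theorem isSymm_tensorForm {B : BilinForm k V} {C : BilinForm k W} (hB : B.IsSymm) (hC : C.IsSymm) :
    (tensorForm B C).IsSymm :=
  ⟨fun x y => (LinearMap.IsSymm.tmul (B₁ := B) (B₂ := C) ⟨hB.eq⟩ ⟨hC.eq⟩).eq x y⟩

theorem nondegenerate_tensorForm [FiniteDimensional k V] [FiniteDimensional k W]
    {B : BilinForm k V} {C : BilinForm k W} (hB : B.IsSymm) (hC : C.IsSymm)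
    (hB' : B.Nondegenerate) (hC' : C.Nondegenerate) : (tensorForm B C).Nondegenerate := by
  refine nondegenerate_of_left (isSymm_tensorForm hB hC) fun x h => ?_
  let e := TensorProduct.congr (B.toDual hB') (C.toDual hC') ≪≫ₗ
    TensorProduct.dualDistribEquiv k V W
  have he : e.toLinearMap = tensorForm B C := by
    ext a b c d
    simp [e, BilinForm.toDual_def, tensorForm_tmul]
  refine e.map_eq_zero_iff.1 (LinearMap.ext fun y => ?_)
  have := LinearMap.congr_fun (LinearMap.congr_fun he x) y
  exact this.trans (h y)

/-- A linear equivalence which preserves the forms is an isometry. -/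
theorem equivalent_of_equiv {B : BilinForm k V} {C : BilinForm k W} (e : V ≃ₗ[k] W)
    (h : ∀ x y, C (e x) (e y) = B x y) : B.Equivalent C :=
  ⟨{ e with map_app' := h }⟩

theorem exists_equiv_of_equivalent {B : BilinForm k V} {C : BilinForm k W} (h : B.Equivalent C) :
    ∃ e : V ≃ₗ[k] W, ∀ x y, C (e x) (e y) = B x y :=
  h.elim fun f => ⟨f.toLinearEquiv, fun x y => f.map_app' x y⟩

theorem tensorForm_equivalent_of_equiv {B : BilinForm k V} {C : BilinForm k W} {D : BilinForm k U}
    (e : V ⊗[k] W ≃ₗ[k] U)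
    (h : ∀ v w v' w', D (e (v ⊗ₜ w)) (e (v' ⊗ₜ w')) = B v v' * C w w') :
    (tensorForm B C).Equivalent D := by
  have key : D.compl₁₂ e.toLinearMap e.toLinearMap = tensorForm B C := by
    ext v w v' w'
    simpa [tensorForm_tmul] using h v w v' w'
  exact equivalent_of_equiv e fun x y => LinearMap.congr_fun (LinearMap.congr_fun key x) y

theorem prodForm_congr {B : BilinForm k V} {B' : BilinForm k V'} {C : BilinForm k W}
    {C' : BilinForm k W'} (h : B.Equivalent B') (h' : C.Equivalent C') :
    (prodForm B C).Equivalent (prodForm B' C') := by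
  obtain ⟨e, he⟩ := exists_equiv_of_equivalent h
  obtain ⟨f, hf⟩ := exists_equiv_of_equivalent h'
  refine equivalent_of_equiv (LinearEquiv.prodCongr e f) fun x y => ?_
  rw [prodForm_apply, prodForm_apply, ← he, ← hf]
  rfl

theorem tensorForm_congr {B : BilinForm k V} {B' : BilinForm k V'} {C : BilinForm k W}
    {C' : BilinForm k W'} (h : B.Equivalent B') (h' : C.Equivalent C') :
    (tensorForm B C).Equivalent (tensorForm B' C') := by
  obtain ⟨e, he⟩ := exists_equiv_of_equivalent h
  obtain ⟨f, hf⟩ := exists_equiv_of_equivalent h'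
  refine tensorForm_equivalent_of_equiv (TensorProduct.congr e f) fun x y x' y' => ?_
  rw [TensorProduct.congr_tmul, TensorProduct.congr_tmul, tensorForm_tmul, he, hf]

theorem tensorForm_comm (B : BilinForm k V) (C : BilinForm k W) :
    (tensorForm B C).Equivalent (tensorForm C B) :=
  tensorForm_equivalent_of_equiv (TensorProduct.comm k V W) fun x y x' y' => by
    rw [TensorProduct.comm_tmul, TensorProduct.comm_tmul, tensorForm_tmul, mul_comm]

theorem tensorForm_prodForm (B : BilinForm k V) (C : BilinForm k W) (D : BilinForm k U) :
    (tensorForm B (prodForm C D)).Equivalent (prodForm (tensorForm B C) (tensorForm B D)) :=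
  tensorForm_equivalent_of_equiv (TensorProduct.prodRight k k V W U) fun x y x' y' => by
    rw [TensorProduct.prodRight_tmul, TensorProduct.prodRight_tmul, prodForm_apply, prodForm_apply,
      tensorForm_tmul, tensorForm_tmul, mul_add]

theorem mul_tensorForm (B : BilinForm k V) :
    (tensorForm (LinearMap.mul k k : BilinForm k k) B).Equivalent B :=
  tensorForm_equivalent_of_equiv (TensorProduct.lid k V) fun a x b y => by
    simp [mul_assoc, mul_left_comm]

theorem tensorForm_assoc (B : BilinForm k V) (C : BilinForm k W) (D : BilinForm k U) :
    (tensorForm (tensorForm B C) D).Equivalent (tensorForm B (tensorForm C D)) := by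
  have key : (tensorForm B (tensorForm C D)).compl₁₂
      (TensorProduct.assoc k V W U).toLinearMap (TensorProduct.assoc k V W U).toLinearMap =
      tensorForm (tensorForm B C) D := by
    ext x y z x' y' z'
    simp [tensorForm_tmul, mul_assoc]
  exact equivalent_of_equiv (TensorProduct.assoc k V W U)
    fun x y => LinearMap.congr_fun (LinearMap.congr_fun key x) y

theorem IsMetabolicForm.prodForm {B : BilinForm k V} {C : BilinForm k W} :
    IsMetabolicForm B → IsMetabolicForm C → IsMetabolicForm (prodForm B C) := by
  rintro ⟨L, hL⟩ ⟨M, hM⟩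
  refine ⟨L.prod M, ?_⟩
  ext z
  rw [mem_orthogonal, Submodule.mem_prod, ← hL, ← hM, mem_orthogonal, mem_orthogonal, hL, hM]
  constructor
  · intro h
    refine ⟨fun x hx => ?_, fun y hy => ?_⟩
    · simpa [prodForm_apply] using h (x, 0) ⟨hx, M.zero_mem⟩
    · simpa [prodForm_apply] using h (0, y) ⟨L.zero_mem, hy⟩
  · rintro ⟨h, h'⟩ x hx
    rw [prodForm_apply, h _ hx.1, h' _ hx.2, add_zero]

theorem isMetabolicForm_prodForm_neg {B : BilinForm k V} (hB : B.Nondegenerate) :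
    IsMetabolicForm (prodForm B (-B)) := by
  refine ⟨LinearMap.eqLocus (LinearMap.fst k V V) (LinearMap.snd k V V), ?_⟩
  ext z
  rw [mem_orthogonal, LinearMap.mem_eqLocus]
  constructor
  · intro h
    refine sub_eq_zero.1 (hB.2 _ fun x => ?_)
    have := h (x, x) rfl
    simpa [prodForm_apply, sub_eq_add_neg] using this
  · intro h x hx
    have h1 : z.1 = z.2 := h
    have h2 : x.1 = x.2 := hx
    rw [prodForm_apply, h1, h2, LinearMap.neg_apply, LinearMap.neg_apply, add_neg_cancel]

theorem IsMetabolicForm.neg {B : BilinForm k V} : IsMetabolicForm B → IsMetabolicForm (-B) := by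
  rintro ⟨L, hL⟩
  refine ⟨L, Eq.trans ?_ hL⟩
  ext z
  simp only [mem_orthogonal, LinearMap.neg_apply, neg_eq_zero]

theorem IsMetabolicForm.tensorForm [FiniteDimensional k V] [FiniteDimensional k W]
    {B : BilinForm k V} {C : BilinForm k W} (hB : B.IsSymm) (hC : C.IsSymm)
    (hB' : B.Nondegenerate) (hC' : C.Nondegenerate) :
    IsMetabolicForm B → IsMetabolicForm (tensorForm B C) := by
  rintro ⟨L, hL⟩
  let N : Submodule k (V ⊗[k] W) := LinearMap.range (LinearMap.rTensor W L.subtype)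
  have hdim : Module.finrank k N = Module.finrank k L * Module.finrank k W := by
    rw [LinearMap.finrank_range_of_inj (Module.Flat.rTensor_preserves_injective_linearMap _
      L.injective_subtype), Module.finrank_tensorProduct]
  have hX : Module.finrank k L = Module.finrank k V - Module.finrank k L := by
    conv_lhs => rw [← hL]
    exact BilinForm.finrank_orthogonal hB' L
  have hle : N ≤ (PresentableWitt.tensorForm B C).orthogonal N := by
    have key : (PresentableWitt.tensorForm B C).compl₁₂ (LinearMap.rTensor W L.subtype)
        (LinearMap.rTensor W L.subtype) = 0 := by
      ext x y x' y'
      have hx' : (x' : V) ∈ B.orthogonal L := by rw [hL]; exact x'.2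
      have : B x x' = 0 := (mem_orthogonal _ _ _).1 hx' x x.2
      simp [tensorForm_tmul, this]
    rintro _ ⟨z, rfl⟩
    rw [mem_orthogonal]
    rintro _ ⟨w, rfl⟩
    exact LinearMap.congr_fun (LinearMap.congr_fun key w) z
  refine ⟨N, (Submodule.eq_of_le_of_finrank_le hle (le_of_eq ?_)).symm⟩
  rw [BilinForm.finrank_orthogonal (nondegenerate_tensorForm hB hC hB' hC'),
    Module.finrank_tensorProduct, hdim, ← Nat.sub_mul, ← hX]

end Forms

/-- A non-degenerate symmetric bilinear form on a finite-dimensional vector space. -/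
structure BilinearSpace (k : Type u) [Field k] where
  carrier : Type u
  [addCommGroup : AddCommGroup carrier]
  [module : Module k carrier]
  [finite : FiniteDimensional k carrier]
  form : BilinForm k carrier
  isSymm : form.IsSymm
  nondegenerate : form.Nondegenerate

namespace BilinearSpace

variable {k : Type u} [Field k]

attribute [instance] addCommGroup module finite

/-- Isometry of bilinear spaces. -/
def Isometric (X Y : BilinearSpace k) : Prop := X.form.Equivalent Y.form

/-- The orthogonal sum. -/
def oplus (X Y : BilinearSpace k) : BilinearSpace k where
  carrier := X.carrier × Y.carrier
  form := prodForm X.form Y.form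
  isSymm := isSymm_prodForm X.isSymm Y.isSymm
  nondegenerate := nondegenerate_prodForm X.isSymm Y.isSymm X.nondegenerate Y.nondegenerate

/-- The tensor product. -/
noncomputable def tensor (X Y : BilinearSpace k) : BilinearSpace k where
  carrier := X.carrier ⊗[k] Y.carrier
  form := tensorForm X.form Y.form
  isSymm := isSymm_tensorForm X.isSymm Y.isSymm
  nondegenerate := nondegenerate_tensorForm X.isSymm Y.isSymm X.nondegenerate Y.nondegenerate

/-- The space with the opposite form. -/
def neg (X : BilinearSpace k) : BilinearSpace k where
  carrier := X.carrier
  form := -X.form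
  isSymm := ⟨fun x y => by simp [X.isSymm.eq x y]⟩
  nondegenerate := nondegenerate_of_left ⟨fun x y => by simp [X.isSymm.eq x y]⟩ fun x h =>
    X.nondegenerate.1 x fun y => by simpa using h y

variable (k) in
/-- The zero space. -/
def zero : BilinearSpace k where
  carrier := PUnit.{u + 1}
  form := 0
  isSymm := ⟨fun _ _ => rfl⟩
  nondegenerate := ⟨fun _ _ => rfl, fun _ _ => rfl⟩

variable (k) in
/-- The one-dimensional form `⟨1⟩`, that is `(x, y) ↦ x y` on `k`. -/
def one : BilinearSpace k where
  carrier := k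
  form := LinearMap.mul k k
  isSymm := ⟨fun x y => mul_comm x y⟩
  nondegenerate := nondegenerate_of_left ⟨fun x y => mul_comm x y⟩ fun x h => by
    simpa using h 1

/-- The bilinear form `(x, y) ↦ ∑ aᵢ xᵢ yᵢ` on `kⁿ`. -/
noncomputable def diagonalForm {n : ℕ} (a : Fin n → kˣ) : BilinForm k (Fin n → k) :=
  ∑ i, (a i : k) • (LinearMap.mul k k).compl₁₂ (LinearMap.proj i) (LinearMap.proj i)

theorem diagonalForm_apply {n : ℕ} (a : Fin n → kˣ) (x y : Fin n → k) :
    diagonalForm a x y = ∑ i, (a i : k) * (x i * y i) := by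
  simp [diagonalForm]

theorem isSymm_diagonalForm {n : ℕ} (a : Fin n → kˣ) : (diagonalForm a).IsSymm :=
  ⟨fun x y => by simp only [diagonalForm_apply, mul_comm (x _)]⟩

/-- The space `⟨a₁, …, aₙ⟩` given by a diagonal form. -/
noncomputable def diagonal {n : ℕ} (a : Fin n → kˣ) : BilinearSpace k where
  carrier := Fin n → k
  form := diagonalForm a
  isSymm := isSymm_diagonalForm a
  nondegenerate := nondegenerate_of_left (isSymm_diagonalForm a) fun x h => by
    funext i
    simpa [diagonalForm_apply, Pi.single_apply] using h (Pi.single i 1)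

/-- Metabolic spaces. -/
def IsMetabolic (X : BilinearSpace k) : Prop := IsMetabolicForm X.form

/-- Witt equivalence: `X ⊕ M ≅ Y ⊕ N` for some metabolic `M` and `N`. -/
def WittEquiv (X Y : BilinearSpace k) : Prop :=
  ∃ M N : BilinearSpace k, M.IsMetabolic ∧ N.IsMetabolic ∧ (X.oplus M).Isometric (Y.oplus N)

theorem Isometric.refl (X : BilinearSpace k) : X.Isometric X := BilinForm.Equivalent.refl _

theorem Isometric.symm {X Y : BilinearSpace k} (h : X.Isometric Y) : Y.Isometric X :=
  BilinForm.Equivalent.symm h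

theorem Isometric.trans {X Y Z : BilinearSpace k} (h : X.Isometric Y) (h' : Y.Isometric Z) :
    X.Isometric Z := BilinForm.Equivalent.trans h h'

theorem oplus_congr {X X' Y Y' : BilinearSpace k} (h : X.Isometric X') (h' : Y.Isometric Y') :
    (X.oplus Y).Isometric (X'.oplus Y') := prodForm_congr h h'

theorem oplus_comm (X Y : BilinearSpace k) : (X.oplus Y).Isometric (Y.oplus X) :=
  equivalent_of_equiv (B := prodForm X.form Y.form) (C := prodForm Y.form X.form)
    (LinearEquiv.prodComm k X.carrier Y.carrier) fun _ _ => add_comm _ _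

theorem oplus_assoc (X Y Z : BilinearSpace k) :
    ((X.oplus Y).oplus Z).Isometric (X.oplus (Y.oplus Z)) :=
  equivalent_of_equiv (B := prodForm (prodForm X.form Y.form) Z.form)
    (C := prodForm X.form (prodForm Y.form Z.form))
    (LinearEquiv.prodAssoc k X.carrier Y.carrier Z.carrier) fun _ _ => (add_assoc _ _ _).symm

theorem oplus_zero (X : BilinearSpace k) : (X.oplus (zero k)).Isometric X :=
  equivalent_of_equiv (B := prodForm X.form (0 : BilinForm k PUnit.{u + 1})) (C := X.form)
    (LinearEquiv.prodUnique (M₂ := PUnit.{u + 1})) fun _ _ => (add_zero _).symm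

theorem oplus_oplus_comm (X Y Z W : BilinearSpace k) :
    ((X.oplus Y).oplus (Z.oplus W)).Isometric ((X.oplus Z).oplus (Y.oplus W)) :=
  equivalent_of_equiv (B := prodForm (prodForm X.form Y.form) (prodForm Z.form W.form))
    (C := prodForm (prodForm X.form Z.form) (prodForm Y.form W.form))
    (LinearEquiv.prodProdProdComm k X.carrier Y.carrier Z.carrier W.carrier)
    fun _ _ => add_add_add_comm _ _ _ _

theorem tensor_congr {X X' Y Y' : BilinearSpace k} (h : X.Isometric X') (h' : Y.Isometric Y') :
    (X.tensor Y).Isometric (X'.tensor Y') := tensorForm_congr h h'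

theorem tensor_comm (X Y : BilinearSpace k) : (X.tensor Y).Isometric (Y.tensor X) :=
  tensorForm_comm X.form Y.form

theorem one_tensor (X : BilinearSpace k) : ((one k).tensor X).Isometric X := mul_tensorForm X.form

theorem tensor_oplus (X Y Z : BilinearSpace k) :
    (X.tensor (Y.oplus Z)).Isometric ((X.tensor Y).oplus (X.tensor Z)) :=
  tensorForm_prodForm X.form Y.form Z.form

theorem tensor_assoc (X Y Z : BilinearSpace k) :
    ((X.tensor Y).tensor Z).Isometric (X.tensor (Y.tensor Z)) :=
  tensorForm_assoc X.form Y.form Z.form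

theorem isMetabolic_zero : (zero k).IsMetabolic :=
  ⟨⊤, Submodule.ext fun _ => ⟨fun _ => trivial, fun _ _ _ => rfl⟩⟩

theorem IsMetabolic.oplus {X Y : BilinearSpace k} (h : X.IsMetabolic) (h' : Y.IsMetabolic) :
    (X.oplus Y).IsMetabolic := IsMetabolicForm.prodForm h h'

theorem isMetabolic_oplus_neg (X : BilinearSpace k) : (X.oplus X.neg).IsMetabolic :=
  isMetabolicForm_prodForm_neg X.nondegenerate

theorem IsMetabolic.tensor {X : BilinearSpace k} (Y : BilinearSpace k) (h : X.IsMetabolic) :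
    (X.tensor Y).IsMetabolic :=
  IsMetabolicForm.tensorForm X.isSymm Y.isSymm X.nondegenerate Y.nondegenerate h

theorem WittEquiv.of_isometric {X Y : BilinearSpace k} (h : X.Isometric Y) : X.WittEquiv Y :=
  ⟨zero k, zero k, isMetabolic_zero, isMetabolic_zero, oplus_congr h (.refl _)⟩

theorem WittEquiv.symm {X Y : BilinearSpace k} : X.WittEquiv Y → Y.WittEquiv X :=
  fun ⟨M, N, hM, hN, h⟩ => ⟨N, M, hN, hM, h.symm⟩

theorem WittEquiv.trans {X Y Z : BilinearSpace k} :
    X.WittEquiv Y → Y.WittEquiv Z → X.WittEquiv Z := by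
  rintro ⟨M, N, hM, hN, h⟩ ⟨M', N', hM', hN', h'⟩
  refine ⟨M.oplus M', N'.oplus N, hM.oplus hM', hN'.oplus hN, ?_⟩
  refine (oplus_assoc _ _ _).symm.trans <| (oplus_congr h (.refl M')).trans <|
    (oplus_assoc _ _ _).trans <| (oplus_congr (.refl Y) (oplus_comm N M')).trans <|
    (oplus_assoc _ _ _).symm.trans <| (oplus_congr h' (.refl N)).trans (oplus_assoc _ _ _)

theorem WittEquiv.oplus {X X' Y Y' : BilinearSpace k} :
    X.WittEquiv X' → Y.WittEquiv Y' → (X.oplus Y).WittEquiv (X'.oplus Y') := by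
  rintro ⟨M, N, hM, hN, h⟩ ⟨M', N', hM', hN', h'⟩
  exact ⟨M.oplus M', N.oplus N', hM.oplus hM', hN.oplus hN',
    (oplus_oplus_comm _ _ _ _).trans <| (oplus_congr h h').trans (oplus_oplus_comm _ _ _ _)⟩

theorem oplus_tensor (X Y Z : BilinearSpace k) :
    ((X.oplus Y).tensor Z).Isometric ((X.tensor Z).oplus (Y.tensor Z)) :=
  (tensor_comm _ _).trans <| (tensor_oplus _ _ _).trans
    (oplus_congr (tensor_comm _ _) (tensor_comm _ _))

theorem WittEquiv.tensor_right (Z : BilinearSpace k) {X Y : BilinearSpace k} :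
    X.WittEquiv Y → (X.tensor Z).WittEquiv (Y.tensor Z) := by
  rintro ⟨M, N, hM, hN, h⟩
  exact ⟨M.tensor Z, N.tensor Z, hM.tensor Z, hN.tensor Z,
    (oplus_tensor _ _ _).symm.trans <| (tensor_congr h (.refl Z)).trans (oplus_tensor _ _ _)⟩

theorem WittEquiv.tensor {X X' Y Y' : BilinearSpace k} (h : X.WittEquiv X')
    (h' : Y.WittEquiv Y') : (X.tensor Y).WittEquiv (X'.tensor Y') :=
  (h.tensor_right Y).trans <| (of_isometric (tensor_comm _ _)).trans <|
    (h'.tensor_right X').trans (of_isometric (tensor_comm _ _))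

theorem IsMetabolic.wittEquiv_zero {X : BilinearSpace k} (h : X.IsMetabolic) :
    X.WittEquiv (zero k) :=
  ⟨zero k, X, isMetabolic_zero, h, oplus_comm _ _⟩

theorem WittEquiv.neg {X Y : BilinearSpace k} : X.WittEquiv Y → X.neg.WittEquiv Y.neg := by
  rintro ⟨M, N, hM, hN, h⟩
  obtain ⟨e, he⟩ := exists_equiv_of_equivalent h
  refine ⟨M.neg, N.neg, IsMetabolicForm.neg hM, IsMetabolicForm.neg hN, ?_⟩
  refine equivalent_of_equiv (B := prodForm (-X.form) (-M.form))
    (C := prodForm (-Y.form) (-N.form)) e fun x y => ?_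
  exact (neg_add _ _).symm.trans ((congrArg _ (he x y)).trans (neg_add _ _))

variable (k) in
/-- Witt equivalence as a setoid. -/
def wittSetoid : Setoid (BilinearSpace k) where
  r := WittEquiv
  iseqv := ⟨fun X => .of_isometric (.refl X), .symm, .trans⟩

end BilinearSpace

/-- The Witt ring `W(k)` of non-degenerate symmetric bilinear forms over a field `k`: Witt
equivalence classes of bilinear spaces, with addition induced by the orthogonal sum and
multiplication induced by the tensor product. -/
def BilinearWittRing (k : Type u) [Field k] : Type (u + 1) := Quotient (BilinearSpace.wittSetoid k)

namespace BilinearWittRing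

open BilinearSpace

variable {k : Type u} [Field k]

/-- The Witt equivalence class of a bilinear space. -/
def mk (X : BilinearSpace k) : BilinearWittRing k := Quotient.mk (wittSetoid k) X

theorem mk_eq_mk_iff {X Y : BilinearSpace k} : mk X = mk Y ↔ X.WittEquiv Y := Quotient.eq

theorem mk_of_isometric {X Y : BilinearSpace k} (h : X.Isometric Y) : mk X = mk Y :=
  mk_eq_mk_iff.2 (.of_isometric h)

theorem ind {P : BilinearWittRing k → Prop} (h : ∀ X, P (mk X)) (x : BilinearWittRing k) : P x :=
  Quotient.ind h x

instance : Zero (BilinearWittRing k) := ⟨mk (zero k)⟩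
instance : One (BilinearWittRing k) := ⟨mk (one k)⟩
instance : Add (BilinearWittRing k) :=
  ⟨Quotient.map₂ oplus fun _ _ h _ _ h' => WittEquiv.oplus h h'⟩
noncomputable instance : Mul (BilinearWittRing k) :=
  ⟨Quotient.map₂ tensor fun _ _ h _ _ h' => WittEquiv.tensor h h'⟩
instance : Neg (BilinearWittRing k) := ⟨Quotient.map neg fun _ _ h => WittEquiv.neg h⟩

theorem mk_add (X Y : BilinearSpace k) : mk X + mk Y = mk (X.oplus Y) := rfl
theorem mk_mul (X Y : BilinearSpace k) : mk X * mk Y = mk (X.tensor Y) := rfl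
theorem mk_neg (X : BilinearSpace k) : -mk X = mk X.neg := rfl
theorem mk_zero : mk (zero k) = 0 := rfl
theorem mk_one : mk (one k) = 1 := rfl

theorem add_comm' (x y : BilinearWittRing k) : x + y = y + x := by
  induction x using ind; induction y using ind
  exact mk_of_isometric (oplus_comm _ _)

theorem mul_comm' (x y : BilinearWittRing k) : x * y = y * x := by
  induction x using ind; induction y using ind
  exact mk_of_isometric (tensor_comm _ _)

theorem add_zero' (x : BilinearWittRing k) : x + 0 = x := by
  induction x using ind
  exact mk_of_isometric (oplus_zero _)

theorem one_mul' (x : BilinearWittRing k) : 1 * x = x := by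
  induction x using ind
  exact mk_of_isometric (one_tensor _)

theorem mul_add' (x y z : BilinearWittRing k) : x * (y + z) = x * y + x * z := by
  induction x using ind; induction y using ind; induction z using ind
  exact mk_of_isometric (tensor_oplus _ _ _)

theorem add_assoc' (x y z : BilinearWittRing k) : x + y + z = x + (y + z) := by
  induction x using ind; induction y using ind; induction z using ind
  exact mk_of_isometric (oplus_assoc _ _ _)

theorem add_neg' (x : BilinearWittRing k) : x + -x = 0 := by
  induction x using ind
  exact mk_eq_mk_iff.2 (isMetabolic_oplus_neg _).wittEquiv_zero

theorem mul_zero' (x : BilinearWittRing k) : x * 0 = 0 := by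
  have h : x * 0 + x * 0 = x * 0 := by rw [← mul_add', add_zero']
  calc x * 0 = x * 0 + (x * 0 + -(x * 0)) := by rw [add_neg', add_zero']
    _ = 0 := by rw [← add_assoc', h, add_neg']

noncomputable instance : CommRing (BilinearWittRing k) where
  add_assoc := add_assoc'
  zero_add x := by rw [add_comm', add_zero']
  add_zero := add_zero'
  add_comm := add_comm'
  nsmul := nsmulRec
  zsmul := zsmulRec
  left_distrib := mul_add'
  right_distrib x y z := by simp only [mul_comm' _ z, mul_add']
  zero_mul x := by rw [mul_comm', mul_zero']
  mul_zero := mul_zero'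
  mul_assoc x y z := by
    induction x using ind; induction y using ind; induction z using ind
    exact mk_of_isometric (tensor_assoc _ _ _)
  one_mul := one_mul'
  mul_one x := by rw [mul_comm', one_mul']
  neg_add_cancel x := by rw [add_comm', add_neg']
  mul_comm := mul_comm'

end BilinearWittRing

end PresentableWitt

/-! The modified addition has a uniform meaning: for non-zero `x`, `y`, `z`, the class of `x` lies
in the sum of the classes of `y` and `z` iff `x p² = y q² + z r²` has a non-trivial solution
(`QuadraticHyperfield.mk_mem_hsum_iff`). The clauses of the modification account exactly for
solutions with a vanishing coordinate. Exchange, associativity and distributivity then become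
symmetries and scalings of ternary and quaternary diagonal forms, in every characteristic. The
pierced powerset inherits the structure of a presentable field, and axiom (ii) is the
multiplicativity of the norm `q² - a p²`.

Isometry over the pierced powerset cannot be matched with isometry over `k`: `⟨a, -a⟩ ≅ ⟨1, -1⟩`
always holds in the former, but can fail over `k` in characteristic 2. It is matched with Witt
classes instead: two forms are isometric iff they have the same length and the same class in `W(k)`
(`formIsometry_iff`). This makes isometry an equivalence relation at once. Since the parity of the
dimension is a Witt invariant, lengths can be equalised by hyperbolic planes, so Witt equivalence of
forms is equality in `W(k)` (`wittEquiv_iff`).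

That isometry preserves the class reduces to the binary relation `⟨a⟩ + ⟨b⟩ = ⟨c⟩ + ⟨abc⟩` in `W(k)`
for `c` in the sum of `a` and `b` (`rankOne_add_rankOne`). The converse is an induction on the
dimension driven by one substitute for Witt cancellation, which fails in characteristic 2: a space
Witt equivalent to one of smaller dimension is isotropic (`WittEquiv.exists_isotropic`). If `⟨a⟩ ⊥
l` and `⟨b⟩ ⊥ m` have equal class and dimension, then `⟨-b, a⟩ ⊥ l` is isotropic, and an isotropic
vector supplies the data required by the inductive definition of isometry (`exists_common_subform`).
Surjectivity onto `W(k)` holds because every space is Witt equivalent to a diagonal one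
(`exists_mk_eq_mk_lines`). -/

namespace PresentableWitt

/-! ### Consequences of the hyperfield axioms -/

namespace IsHyperfield

variable {F : Type u} [Zero F] [One F] [Neg F] [Mul F] [HyperAdd F]

/-- Negatives are unique: exchange turns `0 ∈ hsum b c` into `c ∈ hsum 0 (-b)`, a singleton. The
next lemma rests on the same remark. -/
theorem neg_neg (h : IsHyperfield F) (a : F) : - -a = a := by
  have h1 := h.zero_mem_hsum_neg a
  rw [h.hsum_comm] at h1
  have h2 := h.exchange _ _ _ h1
  rw [h.zero_hsum] at h2
  exact h2.symm

theorem neg_mul (h : IsHyperfield F) (a b : F) : -a * b = -(a * b) := by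
  have h1 : (0 : F) ∈ hsum (b * a) (b * -a) := by
    rw [← h.mul_hsum]
    exact ⟨0, h.zero_mem_hsum_neg a, (h.mul_comm b 0).trans (h.zero_mul b)⟩
  have h2 := h.exchange _ _ _ h1
  rw [h.zero_hsum, h.mul_comm b, h.mul_comm b] at h2
  exact h2

end IsHyperfield

/-! ### The pierced powerset of a hyperfield -/

namespace PiercedPowerset

/-! ### Singletons, suprema and compactness in the pierced powerset -/

section Order

variable {F : Type u}

theorem singleton_le_iff {x : F} {A : PiercedPowerset F} : singleton x ≤ A ↔ x ∈ A.1 :=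
  Set.singleton_subset_iff

theorem singleton_injective : Function.Injective (singleton : F → PiercedPowerset F) :=
  fun _ _ h => Set.singleton_injective (congrArg Subtype.val h)

theorem isMin_iff {A : PiercedPowerset F} : IsMin A ↔ ∃ x, A = singleton x := by
  constructor
  · intro h
    obtain ⟨x, hx⟩ := A.2
    exact ⟨x, h.eq_of_ge (singleton_le_iff.2 hx)⟩
  · rintro ⟨x, rfl⟩
    exact isMin_singleton x

theorem mem_minimalsBelow_iff {A B : PiercedPowerset F} :
    B ∈ minimalsBelow A ↔ ∃ x ∈ A.1, B = singleton x := by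
  constructor
  · rintro ⟨h, hA⟩
    obtain ⟨x, rfl⟩ := isMin_iff.1 h
    exact ⟨x, singleton_le_iff.1 hA, rfl⟩
  · rintro ⟨x, hx, rfl⟩
    exact ⟨isMin_singleton x, singleton_le_iff.2 hx⟩

/-- The union of a non-empty family of non-empty sets is non-empty, so it belongs to the poset and
is the supremum there. -/
theorem isLUB_iff {S : Set (PiercedPowerset F)} (hS : S.Nonempty) {A : PiercedPowerset F} :
    IsLUB S A ↔ ∀ x, x ∈ A.1 ↔ ∃ B ∈ S, x ∈ B.1 := by
  obtain ⟨B₀, hB₀⟩ := hS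
  constructor
  · intro h x
    refine ⟨fun hx => ?_, fun ⟨B, hB, hx⟩ => h.1 hB hx⟩
    have : A ≤ ⟨⋃ B ∈ S, B.1, B₀.2.mono (Set.subset_biUnion_of_mem (u := Subtype.val) hB₀)⟩ :=
      h.2 fun B hB => Set.subset_biUnion_of_mem (u := Subtype.val) hB
    simpa using this hx
  · exact fun h => ⟨fun B hB x hx => (h x).2 ⟨B, hB, hx⟩, fun C hC x hx => by
      obtain ⟨B, hB, hx⟩ := (h x).1 hx
      exact hC hB hx⟩

/-- The supercompacts are the singletons; their compactness says that a point of a union lies in one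
of the members. -/
theorem isPresentable (p : F) : IsPresentable (PiercedPowerset F) (singleton p) where
  exists_isLUB S hS _ := by
    obtain ⟨B₀, hB₀⟩ := hS
    refine ⟨⟨⋃ B ∈ S, B.1, B₀.2.mono (Set.subset_biUnion_of_mem (u := Subtype.val) hB₀)⟩,
      (isLUB_iff ⟨B₀, hB₀⟩).2 fun x => by simp⟩
  isLUB_minimalsBelow A := by
    obtain ⟨a, ha⟩ := A.2
    refine (isLUB_iff ⟨singleton a, mem_minimalsBelow_iff.2 ⟨a, ha, rfl⟩⟩).2 fun x =>
      ⟨fun hx => ⟨_, mem_minimalsBelow_iff.2 ⟨x, hx, rfl⟩, rfl⟩, fun ⟨B, hB, hx⟩ => hB.2 hx⟩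
  isMin_basepoint := isMin_singleton p
  isCompactPoint A hA Y b hY hb hAb := by
    obtain ⟨x, rfl⟩ := isMin_iff.1 hA
    obtain ⟨B, hB, hx⟩ := ((isLUB_iff hY).1 hb x).1 (singleton_le_iff.1 hAb)
    exact ⟨B, hB, singleton_le_iff.2 hx⟩

end Order

/-! ### Arithmetic of the pierced powerset -/

section Operations

variable {F : Type u}

theorem mem_add_iff [HyperAdd F] {A B : PiercedPowerset F} {x : F} :
    x ∈ (A + B).1 ↔ ∃ a ∈ A.1, ∃ b ∈ B.1, x ∈ hsum a b := by
  change x ∈ ⋃ a ∈ A.1, ⋃ b ∈ B.1, hsum a b ↔ _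
  simp

theorem mem_neg_iff [Neg F] {A : PiercedPowerset F} {x : F} :
    x ∈ (-A).1 ↔ ∃ a ∈ A.1, -a = x := Iff.rfl

theorem mem_mul_iff [Mul F] {A B : PiercedPowerset F} {x : F} :
    x ∈ (A * B).1 ↔ ∃ a ∈ A.1, ∃ b ∈ B.1, a * b = x := Iff.rfl

theorem mem_singleton_iff {x y : F} : x ∈ (singleton y).1 ↔ x = y := Iff.rfl

theorem mem_zero_iff [Zero F] {x : F} : x ∈ (0 : PiercedPowerset F).1 ↔ x = 0 := Iff.rfl

theorem mem_one_iff [One F] {x : F} : x ∈ (1 : PiercedPowerset F).1 ↔ x = 1 := Iff.rfl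

theorem ext {A B : PiercedPowerset F} (h : ∀ x, x ∈ A.1 ↔ x ∈ B.1) : A = B :=
  Subtype.ext (Set.ext h)

theorem singleton_mul [Mul F] (x y : F) : singleton x * singleton y = singleton (x * y) :=
  ext fun z => by simp [mem_mul_iff, mem_singleton_iff, eq_comm]

theorem neg_singleton [Neg F] (x : F) : -singleton x = singleton (-x) :=
  ext fun z => by simp [mem_neg_iff, mem_singleton_iff, eq_comm]

theorem singleton_le_add_iff [HyperAdd F] {x y z : F} :
    singleton x ≤ singleton y + singleton z ↔ x ∈ hsum y z := by
  rw [singleton_le_iff, mem_add_iff]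
  simp [mem_singleton_iff]

variable [Zero F] [One F] [Neg F] [Mul F] [HyperAdd F]

/-- The pierced powerset of a hyperfield is a presentable field. -/
theorem isPresentableField (h : IsHyperfield F) : IsPresentableField (PiercedPowerset F) where
  toIsPresentable := isPresentable 0
  isLUB_add X Y a b hX hY ha hb := by
    rw [isLUB_iff (hX.image2 hY)]
    rw [isLUB_iff hX] at ha
    rw [isLUB_iff hY] at hb
    intro x
    simp only [mem_add_iff, ha, hb, Set.exists_mem_image2]
    constructor
    · rintro ⟨y, ⟨A, hA, hy⟩, z, ⟨B, hB, hz⟩, hx⟩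
      exact ⟨A, hA, B, hB, y, hy, z, hz, hx⟩
    · rintro ⟨A, hA, B, hB, y, hy, z, hz, hx⟩
      exact ⟨y, ⟨A, hA, hy⟩, z, ⟨B, hB, hz⟩, hx⟩
  add_assoc A B C := by
    refine ext fun x => ?_
    have key (a b c : F) : (∃ y ∈ hsum b c, x ∈ hsum a y) ↔ ∃ y ∈ hsum a b, x ∈ hsum y c := by
      simpa using (Set.ext_iff.1 (h.hsum_assoc a b c) x).symm
    simp only [mem_add_iff]
    constructor
    · rintro ⟨a, ha, y, ⟨b, hb, c, hc, hy⟩, hx⟩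
      obtain ⟨z, hz, hx⟩ := (key a b c).1 ⟨y, hy, hx⟩
      exact ⟨z, ⟨a, ha, b, hb, hz⟩, c, hc, hx⟩
    · rintro ⟨y, ⟨a, ha, b, hb, hy⟩, c, hc, hx⟩
      obtain ⟨z, hz, hx⟩ := (key a b c).2 ⟨y, hy, hx⟩
      exact ⟨a, ha, z, ⟨b, hb, c, hc, hz⟩, hx⟩
  add_zero A := ext fun x => by simp [mem_add_iff, mem_zero_iff, h.hsum_zero]
  zero_add A := ext fun x => by simp [mem_add_iff, mem_zero_iff, h.zero_hsum]
  add_comm A B := ext fun x => by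
    simp only [mem_add_iff]
    exact ⟨fun ⟨a, ha, b, hb, hx⟩ => ⟨b, hb, a, ha, h.hsum_comm a b ▸ hx⟩,
      fun ⟨a, ha, b, hb, hx⟩ => ⟨b, hb, a, ha, h.hsum_comm a b ▸ hx⟩⟩
  neg_neg A := ext fun x => by simp [mem_neg_iff, h.neg_neg]
  isLUB_neg X A hX hA := by
    rw [isLUB_iff (hX.image _)]
    rw [isLUB_iff hX] at hA
    intro x
    simp only [mem_neg_iff, hA, Set.exists_mem_image]
    exact ⟨fun ⟨a, ⟨B, hB, ha⟩, hx⟩ => ⟨B, hB, a, ha, hx⟩,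
      fun ⟨B, hB, a, ha, hx⟩ => ⟨a, ⟨B, hB, ha⟩, hx⟩⟩
  exchange A B C hA hB hC := by
    obtain ⟨a, rfl⟩ := isMin_iff.1 hA
    obtain ⟨b, rfl⟩ := isMin_iff.1 hB
    obtain ⟨c, rfl⟩ := isMin_iff.1 hC
    rw [neg_singleton, singleton_le_add_iff, singleton_le_add_iff, h.hsum_comm b c]
    exact h.exchange a c b
  mul_assoc A B C := Subtype.ext (Set.image2_assoc h.mul_assoc).symm
  mul_comm A B := Subtype.ext (Set.image2_comm h.mul_comm)
  one_mul A := ext fun x => by simp [mem_mul_iff, mem_one_iff, h.one_mul]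
  mul_le_mul_left A B C hAB := Set.image2_subset_left hAB
  neg_mul A B := ext fun x => by
    simp only [mem_mul_iff, mem_neg_iff]
    constructor
    · rintro ⟨_, ⟨a, ha, rfl⟩, b, hb, rfl⟩
      exact ⟨_, ⟨a, ha, b, hb, rfl⟩, (h.neg_mul a b).symm⟩
    · rintro ⟨_, ⟨a, ha, b, hb, rfl⟩, rfl⟩
      exact ⟨_, ⟨a, ha, rfl⟩, b, hb, h.neg_mul a b⟩
  left_distrib A B C hA := by
    -- For a singleton the same `a` multiplies both summands, so it can be factored out; a larger
    -- set could contribute two different factors.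
    obtain ⟨a, rfl⟩ := isMin_iff.1 hA
    refine ext fun x => ?_
    simp only [mem_mul_iff, mem_add_iff, mem_singleton_iff, exists_eq_left]
    constructor
    · rintro ⟨y, ⟨b, hb, c, hc, hy⟩, rfl⟩
      refine ⟨_, ⟨b, hb, rfl⟩, _, ⟨c, hc, rfl⟩, ?_⟩
      rw [← h.mul_hsum]
      exact ⟨y, hy, rfl⟩
    · rintro ⟨_, ⟨b, hb, rfl⟩, _, ⟨c, hc, rfl⟩, hx⟩
      rw [← h.mul_hsum] at hx
      obtain ⟨y, hy, rfl⟩ := hx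
      exact ⟨y, ⟨b, hb, c, hc, hy⟩, rfl⟩
  minimalsBelow_mul A B := by
    ext C
    simp only [mem_minimalsBelow_iff, Set.mem_image2, mem_mul_iff]
    constructor
    · rintro ⟨_, ⟨a, ha, b, hb, rfl⟩, rfl⟩
      exact ⟨_, ⟨a, ha, rfl⟩, _, ⟨b, hb, rfl⟩, singleton_mul a b⟩
    · rintro ⟨_, ⟨a, ha, rfl⟩, _, ⟨b, hb, rfl⟩, rfl⟩
      exact ⟨_, ⟨a, ha, b, hb, rfl⟩, singleton_mul a b⟩
  isMin_one := isMin_singleton 1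
  one_ne_zero := singleton_ne_zero h.zero_ne_one.symm
  mul_ne_zero A B hA hB hA0 hB0 := by
    obtain ⟨a, rfl⟩ := isMin_iff.1 hA
    obtain ⟨b, rfl⟩ := isMin_iff.1 hB
    have ha : a ≠ 0 := fun ha => hA0 (ha ▸ rfl)
    rw [singleton_mul]
    refine singleton_ne_zero fun hab => hB0 ?_
    obtain ⟨c, hc⟩ := h.exists_inv a ha
    have : b = 0 := by
      rw [← h.one_mul b, ← hc, h.mul_comm a, h.mul_assoc, hab, h.mul_comm, h.zero_mul]
    rw [this]
    rfl
  exists_inv A hA hA0 := by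
    obtain ⟨a, rfl⟩ := isMin_iff.1 hA
    obtain ⟨b, hb⟩ := h.exists_inv a fun ha => hA0 (ha ▸ rfl)
    refine ⟨singleton b, isMin_singleton b, singleton_ne_zero ?_, ?_⟩
    · rintro rfl
      rw [h.mul_comm, h.zero_mul] at hb
      exact h.zero_ne_one hb
    · rw [singleton_mul, hb]
      rfl

end Operations

end PiercedPowerset

/-! ### The quadratic hyperfield -/

namespace QuadraticHyperfield

variable {k : Type u} [Field k]

/-! ### Square classes and the description of sums by zeros of quadratic forms -/

theorem mk_surjective : Function.Surjective (mk : k → QuadraticHyperfield k) := Quotient.mk_surjective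

theorem mk_zero : mk (0 : k) = 0 := rfl
theorem mk_one : mk (1 : k) = 1 := rfl
theorem mk_neg (x : k) : mk (-x) = -mk x := rfl
theorem mk_mul (x y : k) : mk (x * y) = mk x * mk y := rfl

theorem mk_eq_mk_iff {x y : k} : mk x = mk y ↔ ∃ u : k, u ≠ 0 ∧ x = y * u ^ 2 := by
  refine (MulQuotient.mk_eq_mk_iff _).trans ⟨?_, ?_⟩
  · rintro ⟨s, ⟨p, rfl⟩, t, ⟨q, rfl⟩, h⟩
    refine ⟨q / p, by simp, ?_⟩
    push_cast at h
    field_simp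
    linear_combination h
  · rintro ⟨u, hu, rfl⟩
    exact ⟨1, one_mem _, Units.mk0 u hu * Units.mk0 u hu, ⟨_, rfl⟩, by simp [pow_two]⟩

theorem mk_eq_zero_iff {x : k} : mk x = 0 ↔ x = 0 := by
  rw [← mk_zero, mk_eq_mk_iff]
  simp only [zero_mul, exists_and_right, and_iff_right_iff_imp]
  exact fun _ => ⟨1, one_ne_zero⟩

/-- The sum in the quotient hyperfield `k /ₘ k*²`, before the modification. -/
def quotientHsum (a b : QuadraticHyperfield k) : Set (QuadraticHyperfield k) :=
  hsum (F := MulQuotient (Subgroup.square kˣ)) a b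

theorem hsum_eq_of_eq_zero {a b : QuadraticHyperfield k} (h : a = 0 ∨ b = 0) :
    hsum a b = quotientHsum a b :=
  congrArg Subtype.val (if_pos h)

theorem hsum_eq_univ {a b : QuadraticHyperfield k} (ha : a ≠ 0) (hb : b ≠ 0) (h : a = -b) :
    hsum a b = Set.univ :=
  congrArg Subtype.val ((if_neg (not_or.2 ⟨ha, hb⟩)).trans (if_pos h))

theorem hsum_eq_union {a b : QuadraticHyperfield k} (ha : a ≠ 0) (hb : b ≠ 0) (h : a ≠ -b) :
    hsum a b = quotientHsum a b ∪ {a, b} :=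
  congrArg Subtype.val ((if_neg (not_or.2 ⟨ha, hb⟩)).trans (if_neg h))

theorem mk_mem_quotientHsum_iff {x y z : k} :
    mk x ∈ quotientHsum (mk y) (mk z) ↔
      ∃ s t u : k, s ≠ 0 ∧ t ≠ 0 ∧ u ≠ 0 ∧ x * s ^ 2 = y * t ^ 2 + z * u ^ 2 := by
  refine (MulQuotient.mk_mem_hsum_iff _ x y z).trans ⟨?_, ?_⟩
  · rintro ⟨s, ⟨p, rfl⟩, t, ⟨q, rfl⟩, u, ⟨r, rfl⟩, h⟩
    refine ⟨p, q, r, p.ne_zero, q.ne_zero, r.ne_zero, ?_⟩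
    push_cast at h
    linear_combination h
  · rintro ⟨s, t, u, hs, ht, hu, h⟩
    refine ⟨_, ⟨Units.mk0 s hs, rfl⟩, _, ⟨Units.mk0 t ht, rfl⟩, _, ⟨Units.mk0 u hu, rfl⟩, ?_⟩
    simpa [pow_two] using h

theorem hsum_zero (a : QuadraticHyperfield k) : hsum a 0 = {a} := by
  obtain ⟨y, rfl⟩ := mk_surjective a
  ext b
  obtain ⟨x, rfl⟩ := mk_surjective b
  rw [hsum_eq_of_eq_zero (.inr rfl), Set.mem_singleton_iff, ← mk_zero, mk_mem_quotientHsum_iff,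
    mk_eq_mk_iff]
  constructor
  · rintro ⟨s, t, u, hs, ht, hu, h⟩
    refine ⟨t / s, div_ne_zero ht hs, ?_⟩
    field_simp
    linear_combination h
  · rintro ⟨u, hu, rfl⟩
    exact ⟨1, u, 1, one_ne_zero, hu, one_ne_zero, by ring⟩

theorem zero_hsum (a : QuadraticHyperfield k) : hsum 0 a = {a} := by
  obtain ⟨y, rfl⟩ := mk_surjective a
  rw [← hsum_zero]
  ext b
  obtain ⟨x, rfl⟩ := mk_surjective b
  rw [hsum_eq_of_eq_zero (.inl rfl), hsum_eq_of_eq_zero (.inr rfl), ← mk_zero,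
    mk_mem_quotientHsum_iff, mk_mem_quotientHsum_iff]
  constructor <;> rintro ⟨s, t, u, hs, ht, hu, h⟩ <;>
    exact ⟨s, u, t, hs, hu, ht, by linear_combination h⟩

theorem mk_eq_neg_mk_iff {y z : k} :
    mk y = -mk z ↔ ∃ u : k, u ≠ 0 ∧ y + z * u ^ 2 = 0 := by
  rw [← mk_neg, mk_eq_mk_iff]
  simp only [neg_mul, eq_neg_iff_add_eq_zero]

/-- The modification creates no new zero sums: `{a, b}` is adjoined only when `a` and `b` are
non-zero, and everything only when `a = -b`. In the unmodified sum, `0 = y t² + z u²` with `t`, `u`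
non-zero already makes the classes opposite. -/
theorem zero_mem_hsum_iff {a b : QuadraticHyperfield k} : 0 ∈ hsum a b ↔ a = -b := by
  obtain ⟨y, rfl⟩ := mk_surjective a
  obtain ⟨z, rfl⟩ := mk_surjective b
  by_cases hy : mk y = 0
  · rw [hy, zero_hsum, Set.mem_singleton_iff, ← mk_neg, ← mk_zero, mk_eq_mk_iff, mk_eq_mk_iff]
    simp
  by_cases hz : mk z = 0
  · rw [hz, hsum_zero, Set.mem_singleton_iff, ← mk_zero, ← mk_neg, neg_zero]
    exact eq_comm
  by_cases h : mk y = -mk z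
  · rw [hsum_eq_univ hy hz h]
    simp [h]
  · rw [hsum_eq_union hy hz h]
    refine iff_of_false ?_ h
    rintro (h' | h' | h')
    · rw [← mk_zero, mk_mem_quotientHsum_iff] at h'
      obtain ⟨s, t, u, -, ht, hu, h'⟩ := h'
      refine h (mk_eq_neg_mk_iff.2 ⟨u / t, div_ne_zero hu ht, ?_⟩)
      field_simp
      linear_combination -h'
    · exact hy h'.symm
    · exact hz h'.symm

/-- For nonzero classes, `x̄ ∈ ȳ +' z̄` if and only if the quadratic form
`-x p² + y q² + z r²` has a nontrivial zero. -/
theorem mk_mem_hsum_iff {x y z : k} (hx : x ≠ 0) (hy : y ≠ 0) (hz : z ≠ 0) :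
    mk x ∈ hsum (mk y) (mk z) ↔
      ∃ p q r : k, ¬(p = 0 ∧ q = 0 ∧ r = 0) ∧ x * p ^ 2 = y * q ^ 2 + z * r ^ 2 := by
  have hy' : mk y ≠ 0 := fun h => hy (mk_eq_zero_iff.1 h)
  have hz' : mk z ≠ 0 := fun h => hz (mk_eq_zero_iff.1 h)
  -- The clauses of the addition match the coordinates that may vanish: `p = 0` occurs when the
  -- summands are opposite, `r = 0` gives the class of `y`, `q = 0` gives the class of `z`, and no
  -- vanishing coordinate gives the unmodified sum.
  by_cases h : mk y = -mk z
  · rw [hsum_eq_univ hy' hz' h]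
    obtain ⟨u, hu, h⟩ := mk_eq_neg_mk_iff.1 h
    exact iff_of_true trivial ⟨0, 1, u, by simp, by linear_combination -h⟩
  rw [hsum_eq_union hy' hz' h]
  constructor
  · rintro (h' | h' | h')
    · obtain ⟨s, t, u, hs, -, -, h'⟩ := mk_mem_quotientHsum_iff.1 h'
      exact ⟨s, t, u, fun H => hs H.1, h'⟩
    · obtain ⟨u, -, h'⟩ := mk_eq_mk_iff.1 h'
      exact ⟨1, u, 0, by simp, by linear_combination h'⟩
    · obtain ⟨u, -, h'⟩ := mk_eq_mk_iff.1 h'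
      exact ⟨1, 0, u, by simp, by linear_combination h'⟩
  · rintro ⟨p, q, r, hpqr, hsum⟩
    by_cases hq : q = 0
    · subst hq
      have hp : p ≠ 0 := by
        rintro rfl
        have : r = 0 := by simpa [hz] using hsum
        simp [this] at hpqr
      have hr : r ≠ 0 := by
        rintro rfl
        simp [hx, hp] at hsum
      refine .inr (.inr (mk_eq_mk_iff.2 ⟨r / p, div_ne_zero hr hp, ?_⟩))
      field_simp
      linear_combination hsum
    by_cases hr : r = 0
    · subst hr
      have hp : p ≠ 0 := by
        rintro rfl
        simp [hy, hq] at hsum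
      refine .inr (.inl (mk_eq_mk_iff.2 ⟨q / p, div_ne_zero hq hp, ?_⟩))
      field_simp
      linear_combination hsum
    have hp : p ≠ 0 := by
      rintro rfl
      refine h (mk_eq_neg_mk_iff.2 ⟨r / q, div_ne_zero hr hq, ?_⟩)
      field_simp
      linear_combination -hsum
    exact .inl (mk_mem_quotientHsum_iff.2 ⟨p, q, r, hp, hq, hr, hsum⟩)

/-! ### The hyperfield axioms -/

theorem neg_neg (a : QuadraticHyperfield k) : - -a = a := by
  obtain ⟨x, rfl⟩ := mk_surjective a
  rw [← mk_neg, ← mk_neg, _root_.neg_neg]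

theorem hsum_comm (a b : QuadraticHyperfield k) : hsum a b = hsum b a := by
  obtain ⟨y, rfl⟩ := mk_surjective a
  obtain ⟨z, rfl⟩ := mk_surjective b
  by_cases hy : y = 0
  · rw [hy, mk_zero, zero_hsum, hsum_zero]
  by_cases hz : z = 0
  · rw [hz, mk_zero, zero_hsum, hsum_zero]
  ext c
  obtain ⟨x, rfl⟩ := mk_surjective c
  by_cases hx : x = 0
  · rw [hx, mk_zero, zero_mem_hsum_iff, zero_mem_hsum_iff]
    exact ⟨fun h => by rw [h, neg_neg], fun h => by rw [h, neg_neg]⟩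
  rw [mk_mem_hsum_iff hx hy hz, mk_mem_hsum_iff hx hz hy]
  constructor <;> rintro ⟨p, q, r, h, h'⟩ <;>
    exact ⟨p, r, q, by tauto, by linear_combination h'⟩

/-- Iterated sums of nonzero classes in terms of nontrivial zeros of quadratic forms. -/
theorem exists_mem_hsum_iff {a b c d : k} (ha : a ≠ 0) (hb : b ≠ 0) (hc : c ≠ 0) (hd : d ≠ 0) :
    (∃ x ∈ hsum (mk a) (mk b), mk d ∈ hsum x (mk c)) ↔
      ∃ p q r s : k, ¬(p = 0 ∧ q = 0 ∧ r = 0 ∧ s = 0) ∧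
        d * p ^ 2 = a * q ^ 2 + b * r ^ 2 + c * s ^ 2 := by
  constructor
  · rintro ⟨x, h₁, h₂⟩
    obtain ⟨x, rfl⟩ := mk_surjective x
    by_cases hx : x = 0
    · rw [hx, mk_zero, zero_mem_hsum_iff, mk_eq_neg_mk_iff] at h₁
      obtain ⟨u, hu, h⟩ := h₁
      exact ⟨0, 1, u, 0, by simp, by linear_combination -h⟩
    obtain ⟨p, q, r, h, h₁⟩ := (mk_mem_hsum_iff hx ha hb).1 h₁
    obtain ⟨p', q', r', h', h₂⟩ := (mk_mem_hsum_iff hd hx hc).1 h₂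
    by_cases hp : p = 0
    · exact ⟨0, q, r, 0, by tauto, by rw [hp] at h₁; linear_combination h₁⟩
    by_cases hq : q' = 0
    · exact ⟨p', 0, 0, r', by tauto, by rw [hq] at h₂; linear_combination h₂⟩
    -- Eliminate `x`: scale the first equation by `q' ^ 2`, the second by `p ^ 2`, and add.
    refine ⟨p * p', q * q', r * q', p * r', ?_, by
      linear_combination q' ^ 2 * h₁ + p ^ 2 * h₂⟩
    simp only [mul_eq_zero, hp, hq, false_or, or_false]
    rintro ⟨-, rfl, rfl, -⟩
    simp [hx, hp] at h₁
  · rintro ⟨p, q, r, s, h, h'⟩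
    -- The natural intermediate class is that of `a q² + b r²`. If this value is zero with `q = r =
    -- 0`, then `a` itself serves; if it is zero non-trivially, the sum of `a` and `b` contains
    -- every class and `d` serves.
    by_cases hx : a * q ^ 2 + b * r ^ 2 = 0
    · by_cases hqr : q = 0 ∧ r = 0
      · exact ⟨mk a, (mk_mem_hsum_iff ha ha hb).2 ⟨1, 1, 0, by simp, by ring⟩,
          (mk_mem_hsum_iff hd ha hc).2 ⟨p, 0, s, by tauto, by linear_combination h' + hx⟩⟩
      · exact ⟨mk d, (mk_mem_hsum_iff hd ha hb).2 ⟨0, q, r, by tauto, by linear_combination -hx⟩,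
          (mk_mem_hsum_iff hd hd hc).2 ⟨1, 1, 0, by simp, by ring⟩⟩
    · exact ⟨mk (a * q ^ 2 + b * r ^ 2),
        (mk_mem_hsum_iff hx ha hb).2 ⟨1, q, r, by simp, by ring⟩,
        (mk_mem_hsum_iff hd hx hc).2 ⟨p, 1, s, by simp, by linear_combination h'⟩⟩

/-- For non-zero entries this is a permutation of coordinates, `z r² = x p² - y q²`. Zero entries
lie outside the criterion and are settled by the singleton sums and `zero_mem_hsum_iff`. -/
theorem exchange (a b c : QuadraticHyperfield k) (h : a ∈ hsum b c) : c ∈ hsum a (-b) := by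
  obtain ⟨x, rfl⟩ := mk_surjective a
  obtain ⟨y, rfl⟩ := mk_surjective b
  obtain ⟨z, rfl⟩ := mk_surjective c
  by_cases hx : x = 0
  · rw [hx, mk_zero, zero_mem_hsum_iff] at h
    rw [hx, mk_zero, zero_hsum, h, neg_neg]
    rfl
  by_cases hy : y = 0
  · rw [hy, mk_zero, zero_hsum, Set.mem_singleton_iff] at h
    rw [hy, ← mk_neg, neg_zero, mk_zero, hsum_zero, h]
    rfl
  by_cases hz : z = 0
  · rw [hz, mk_zero, hsum_zero, Set.mem_singleton_iff] at h
    rw [hz, mk_zero, zero_mem_hsum_iff, neg_neg, h]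
  rw [mk_mem_hsum_iff hx hy hz] at h
  rw [← mk_neg, mk_mem_hsum_iff hz hx (neg_ne_zero.2 hy)]
  obtain ⟨p, q, r, h, h'⟩ := h
  exact ⟨r, p, q, by tauto, by linear_combination -h'⟩

/-- Both sides say that `a`, `b`, `c` have zero among their sums, a cyclically symmetric condition.
It settles the membership of `0` in associativity. -/
theorem neg_mem_hsum_iff {a b c : QuadraticHyperfield k} :
    -c ∈ hsum a b ↔ -a ∈ hsum b c := by
  have key (a b c : QuadraticHyperfield k) (h : -c ∈ hsum a b) : -a ∈ hsum b c := by
    simpa only [neg_neg] using exchange _ _ _ (exchange _ _ _ h)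
  exact ⟨key a b c, fun h => key c a b (key b c a h)⟩

/-- For non-zero `a`, `b`, `c`, `d`, either bracketing contains `d` iff the quaternary form `⟨-d, a,
b, c⟩` has a non-trivial zero, and this does not depend on the order of `a`, `b`, `c`. -/
theorem hsum_assoc (a b c : QuadraticHyperfield k) :
    ⋃ x ∈ hsum a b, hsum x c = ⋃ x ∈ hsum b c, hsum a x := by
  by_cases ha : a = 0
  · simp [ha, zero_hsum]
  by_cases hb : b = 0
  · simp [hb, zero_hsum, hsum_zero]
  by_cases hc : c = 0
  · simp [hc, hsum_zero]
  ext d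
  simp only [Set.mem_iUnion, exists_prop]
  by_cases hd : d = 0
  · subst hd
    simp only [zero_mem_hsum_iff]
    constructor
    · rintro ⟨x, hx, rfl⟩
      exact ⟨-a, neg_mem_hsum_iff.1 hx, (neg_neg a).symm⟩
    · rintro ⟨x, hx, rfl⟩
      exact ⟨-c, neg_mem_hsum_iff.2 (by rwa [neg_neg]), rfl⟩
  have hcomm (x : QuadraticHyperfield k) : hsum a x = hsum x a := hsum_comm a x
  simp only [hcomm]
  obtain ⟨a, rfl⟩ := mk_surjective a
  obtain ⟨b, rfl⟩ := mk_surjective b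
  obtain ⟨c, rfl⟩ := mk_surjective c
  obtain ⟨d, rfl⟩ := mk_surjective d
  rw [mk_eq_zero_iff] at ha hb hc hd
  rw [exists_mem_hsum_iff hb ha hc hd, exists_mem_hsum_iff hb hc ha hd]
  constructor <;> rintro ⟨p, q, r, s, h, h'⟩ <;>
    exact ⟨p, q, s, r, by tauto, by linear_combination h'⟩

theorem mul_hsum (a b c : QuadraticHyperfield k) :
    (fun x => a * x) '' hsum b c = hsum (a * b) (a * c) := by
  obtain ⟨a, rfl⟩ := mk_surjective a
  obtain ⟨b, rfl⟩ := mk_surjective b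
  obtain ⟨c, rfl⟩ := mk_surjective c
  rw [← mk_mul, ← mk_mul]
  by_cases ha : a = 0
  · subst ha
    rw [zero_mul, zero_mul, mk_zero, hsum_zero]
    ext x
    have (y : QuadraticHyperfield k) : 0 * y = 0 := by
      obtain ⟨y, rfl⟩ := mk_surjective y
      rw [← mk_zero, ← mk_mul, zero_mul]
    simp only [this, Set.mem_image, Set.mem_singleton_iff]
    obtain ⟨y, hy⟩ := hsum_nonempty (mk b) (mk c)
    exact ⟨fun ⟨_, _, h⟩ => h.symm, fun h => ⟨y, hy, h.symm⟩⟩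
  by_cases hb : b = 0
  · rw [hb, mul_zero, mk_zero, zero_hsum, zero_hsum, Set.image_singleton, mk_mul]
  by_cases hc : c = 0
  · rw [hc, mul_zero, mk_zero, hsum_zero, hsum_zero, Set.image_singleton, mk_mul]
  ext d
  obtain ⟨d, rfl⟩ := mk_surjective d
  have key (x : k) : mk (a * x) ∈ hsum (mk (a * b)) (mk (a * c)) ↔ mk x ∈ hsum (mk b) (mk c) := by
    by_cases hx : x = 0
    · rw [hx, mul_zero, mk_zero, zero_mem_hsum_iff, zero_mem_hsum_iff, mk_eq_neg_mk_iff,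
        mk_eq_neg_mk_iff]
      simp only [mul_assoc, ← mul_add, mul_eq_zero, ha, false_or]
    · rw [mk_mem_hsum_iff (mul_ne_zero ha hx) (mul_ne_zero ha hb) (mul_ne_zero ha hc),
        mk_mem_hsum_iff hx hb hc]
      simp only [mul_assoc, ← mul_add, mul_right_inj' ha]
  constructor
  · rintro ⟨x, hx, h⟩
    obtain ⟨x, rfl⟩ := mk_surjective x
    rw [← h]
    exact (key x).2 hx
  · intro h
    have hd : d = a * (a⁻¹ * d) := by field_simp
    rw [hd] at h ⊢
    exact ⟨_, (key _).1 h, rfl⟩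

variable (k) in
theorem isHyperfield : IsHyperfield (QuadraticHyperfield k) where
  hsum_zero := hsum_zero
  zero_hsum := zero_hsum
  hsum_comm := hsum_comm
  hsum_assoc := hsum_assoc
  zero_mem_hsum_neg a := zero_mem_hsum_iff.2 (neg_neg a).symm
  exchange := exchange
  mul_assoc a b c := by
    obtain ⟨a, rfl⟩ := mk_surjective a
    obtain ⟨b, rfl⟩ := mk_surjective b
    obtain ⟨c, rfl⟩ := mk_surjective c
    exact congrArg mk (mul_assoc a b c)
  mul_comm a b := by
    obtain ⟨a, rfl⟩ := mk_surjective a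
    obtain ⟨b, rfl⟩ := mk_surjective b
    exact congrArg mk (mul_comm a b)
  one_mul a := by
    obtain ⟨a, rfl⟩ := mk_surjective a
    exact congrArg mk (one_mul a)
  zero_mul a := by
    obtain ⟨a, rfl⟩ := mk_surjective a
    exact congrArg mk (zero_mul a)
  mul_hsum := mul_hsum
  zero_ne_one h := one_ne_zero (mk_eq_zero_iff.1 h.symm)
  exists_inv a ha := by
    obtain ⟨a, rfl⟩ := mk_surjective a
    rw [Ne, mk_eq_zero_iff] at ha
    exact ⟨mk a⁻¹, congrArg mk (mul_inv_cancel₀ ha)⟩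

/-! ### The axioms of pre-quadratic presentability -/

theorem left_mem_hsum {a : QuadraticHyperfield k} (ha : a ≠ 0) (b : QuadraticHyperfield k) :
    a ∈ hsum a b := by
  obtain ⟨a, rfl⟩ := mk_surjective a
  obtain ⟨b, rfl⟩ := mk_surjective b
  by_cases hb : b = 0
  · rw [hb, mk_zero, hsum_zero]
    rfl
  rw [Ne, mk_eq_zero_iff] at ha
  exact (mk_mem_hsum_iff ha ha hb).2 ⟨1, 1, 0, by simp, by ring⟩

theorem mul_self {a : QuadraticHyperfield k} (ha : a ≠ 0) : a * a = 1 := by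
  obtain ⟨a, rfl⟩ := mk_surjective a
  rw [Ne, mk_eq_zero_iff] at ha
  exact mk_eq_mk_iff.2 ⟨a, ha, by ring⟩

/-- The hypotheses say that `b` and `c` are, up to squares, values of the norm form `q² - a p²`.
Such values are closed under products. -/
theorem mem_one_sub_mul {a b c : QuadraticHyperfield k} (hb : a ∈ hsum 1 (-b))
    (hc : a ∈ hsum 1 (-c)) : a ∈ hsum 1 (-(b * c)) := by
  have h1 : (1 : QuadraticHyperfield k) ≠ 0 := (isHyperfield k).zero_ne_one.symm
  by_cases ha1 : a = 1
  · rw [ha1]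
    exact left_mem_hsum h1 _
  have hne (b : QuadraticHyperfield k) (h : a ∈ hsum 1 (-b)) : b ≠ 0 := by
    rintro rfl
    rw [← mk_zero, ← mk_neg, neg_zero, mk_zero, hsum_zero] at h
    exact ha1 h
  have hb0 := hne b hb
  have hc0 := hne c hc
  obtain ⟨b, rfl⟩ := mk_surjective b
  obtain ⟨c, rfl⟩ := mk_surjective c
  obtain ⟨a, rfl⟩ := mk_surjective a
  rw [Ne, mk_eq_zero_iff] at hb0 hc0
  rw [← mk_one] at hb hc ha1 ⊢
  rw [← mk_mul]
  rw [← mk_neg] at hb hc ⊢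
  have hbc : b * c ≠ 0 := mul_ne_zero hb0 hc0
  by_cases ha0 : a = 0
  · rw [ha0, mk_zero, zero_mem_hsum_iff, mk_neg, neg_neg] at hb hc ⊢
    rw [mk_mul, ← hb, ← hc, ← mk_mul, one_mul]
  rw [mk_mem_hsum_iff ha0 one_ne_zero (neg_ne_zero.2 hb0)] at hb
  rw [mk_mem_hsum_iff ha0 one_ne_zero (neg_ne_zero.2 hc0)] at hc
  rw [mk_mem_hsum_iff ha0 one_ne_zero (neg_ne_zero.2 hbc)]
  -- A solution with `r = 0` would make `a` a square, the case already disposed of. Hence the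
  -- product `r * r'` below is non-zero and certifies non-triviality.
  have hr (b p q r : k) (h : ¬(p = 0 ∧ q = 0 ∧ r = 0))
      (h' : a * p ^ 2 = 1 * q ^ 2 + -b * r ^ 2) : r ≠ 0 := by
    rintro rfl
    have hp : p ≠ 0 := by
      rintro rfl
      exact h ⟨rfl, by simpa using h'.symm, rfl⟩
    have hq : q ≠ 0 := by
      rintro rfl
      simp [ha0, hp] at h'
    refine ha1 (mk_eq_mk_iff.2 ⟨q / p, div_ne_zero hq hp, ?_⟩)
    field_simp
    linear_combination h'
  obtain ⟨p, q, r, h, hb⟩ := hb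
  obtain ⟨p', q', r', h', hc⟩ := hc
  -- Coefficients of the product `(q + p√a)(q' + p'√a)`.
  refine ⟨p * q' + q * p', q * q' + a * p * p', r * r', ?_, ?_⟩
  · exact fun H => mul_ne_zero (hr _ _ _ _ h hb) (hr _ _ _ _ h' hc) H.2.2
  · linear_combination (q' ^ 2 - a * p' ^ 2) * hb + b * r ^ 2 * hc

variable (k) in
/-- The pierced powerset of the quadratic hyperfield is pre-quadratically presentable. -/
theorem isPreQuadraticallyPresentable :
    IsPreQuadraticallyPresentable (PiercedPowerset (QuadraticHyperfield k)) where
  toIsPresentableField := PiercedPowerset.isPresentableField (isHyperfield k)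
  le_add A B hA hA0 hB := by
    obtain ⟨a, rfl⟩ := PiercedPowerset.isMin_iff.1 hA
    obtain ⟨b, rfl⟩ := PiercedPowerset.isMin_iff.1 hB
    exact PiercedPowerset.singleton_le_add_iff.2 (left_mem_hsum (fun h => hA0 (congrArg _ h)) b)
  le_one_sub_mul A B C hA hB hC := by
    obtain ⟨a, rfl⟩ := PiercedPowerset.isMin_iff.1 hA
    obtain ⟨b, rfl⟩ := PiercedPowerset.isMin_iff.1 hB
    obtain ⟨c, rfl⟩ := PiercedPowerset.isMin_iff.1 hC
    change _ ≤ PiercedPowerset.singleton 1 + _ → _ ≤ PiercedPowerset.singleton 1 + _ →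
      _ ≤ PiercedPowerset.singleton 1 + _
    rw [PiercedPowerset.singleton_mul, PiercedPowerset.neg_singleton,
      PiercedPowerset.neg_singleton, PiercedPowerset.neg_singleton,
      PiercedPowerset.singleton_le_add_iff, PiercedPowerset.singleton_le_add_iff,
      PiercedPowerset.singleton_le_add_iff]
    exact mem_one_sub_mul
  mul_self A hA hA0 := by
    obtain ⟨a, rfl⟩ := PiercedPowerset.isMin_iff.1 hA
    rw [PiercedPowerset.singleton_mul, mul_self fun h => hA0 (congrArg _ h)]
    rfl

end QuadraticHyperfield

end PresentableWitt

namespace PresentableWitt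

/-! ### Isotropic vectors and splittings of bilinear spaces -/

open scoped TensorProduct

open LinearMap (BilinForm)

section Forms

variable {k : Type u} [Field k]
variable {V : Type u} [AddCommGroup V] [Module k V] [FiniteDimensional k V]
variable {V' : Type u} [AddCommGroup V'] [Module k V'] [FiniteDimensional k V']
variable {W : Type u} [AddCommGroup W] [Module k W] [FiniteDimensional k W]
variable {W' : Type u} [AddCommGroup W'] [Module k W'] [FiniteDimensional k W']

/-- A totally isotropic subspace `Q` larger than `P` contains a vector which is orthogonal to `P` but
does not belong to `P`. -/
theorem exists_mem_orthogonal_notMem {B : BilinForm k V} (hB : B.Nondegenerate)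
    {P Q : Submodule k V} (hQ : Q ≤ B.orthogonal Q)
    (h : Module.finrank k P < Module.finrank k Q) : ∃ v ∈ Q, v ∈ B.orthogonal P ∧ v ∉ P := by
  by_contra! H
  -- If `Q ⊓ P^⊥ ≤ P`, then, as `Q + P^⊥ ≤ (Q ⊓ P)^⊥`, the dimension formula gives `dim Q + (n - dim
  -- P) ≤ (n - dim (Q ⊓ P)) + dim (Q ⊓ P) = n`, that is `dim Q ≤ dim P`.
  have h1 := Submodule.finrank_sup_add_finrank_inf_eq Q (B.orthogonal P)
  have h2 : Module.finrank k ↥(Q ⊔ B.orthogonal P) ≤ Module.finrank k (B.orthogonal (Q ⊓ P)) :=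
    Submodule.finrank_mono (sup_le (hQ.trans (BilinForm.orthogonal_le inf_le_left))
      (BilinForm.orthogonal_le inf_le_right))
  have h3 : Module.finrank k ↥(Q ⊓ B.orthogonal P) ≤ Module.finrank k ↥(Q ⊓ P) :=
    Submodule.finrank_mono fun v hv => ⟨hv.1, H v hv.1 hv.2⟩
  rw [BilinForm.finrank_orthogonal hB] at h1 h2
  have h4 := Submodule.finrank_le P
  have h5 := Submodule.finrank_le (Q ⊓ P)
  omega

theorem finrank_eq_two_mul_of_orthogonal_eq {B : BilinForm k V} (hB : B.Nondegenerate)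
    {L : Submodule k V} (hL : B.orthogonal L = L) :
    Module.finrank k V = 2 * Module.finrank k L := by
  have h := BilinForm.finrank_orthogonal hB L
  have h' := Submodule.finrank_le L
  rw [hL] at h
  omega

/-- If `B ⊥ M ≅ C ⊥ N` with `M`, `N` metabolic and `dim C < dim B`, then `B` is isotropic. -/
theorem exists_isotropic_of_equivalent {B : BilinForm k V} {M : BilinForm k W}
    {C : BilinForm k V'} {N : BilinForm k W'} (hBM : (prodForm B M).Nondegenerate)
    (hM : M.Nondegenerate) (hN : N.Nondegenerate) (hM' : IsMetabolicForm M)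
    (hN' : IsMetabolicForm N) (h : (prodForm B M).Equivalent (prodForm C N))
    (hlt : Module.finrank k V' < Module.finrank k V) : ∃ v : V, v ≠ 0 ∧ B v v = 0 := by
  obtain ⟨L, hL⟩ := hM'
  obtain ⟨L', hL'⟩ := hN'
  obtain ⟨e, he⟩ := exists_equiv_of_equivalent h
  have hdim := e.finrank_eq
  rw [Module.finrank_prod, Module.finrank_prod, finrank_eq_two_mul_of_orthogonal_eq hM hL,
    finrank_eq_two_mul_of_orthogonal_eq hN hL'] at hdim
  -- Compare `P = 0 ⊕ L` with `Q`, the preimage of `0 ⊕ L'` under the isometry. From `dim V + 2 dim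
  -- L = dim V' + 2 dim L'` and `dim V' < dim V` it follows that `dim P < dim Q`.
  let f : L →ₗ[k] V × W := LinearMap.inr k V W ∘ₗ L.subtype
  let g : L' →ₗ[k] V × W := e.symm.toLinearMap ∘ₗ LinearMap.inr k V' W' ∘ₗ L'.subtype
  have hf : Function.Injective f := LinearMap.inr_injective.comp L.injective_subtype
  have hg : Function.Injective g :=
    e.symm.injective.comp (LinearMap.inr_injective.comp L'.injective_subtype)
  have hQ : LinearMap.range g ≤ (prodForm B M).orthogonal (LinearMap.range g) := by
    rintro _ ⟨x, rfl⟩ _ ⟨y, rfl⟩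
    have hx : (x : W') ∈ N.orthogonal L' := by rw [hL']; exact x.2
    rw [← he]
    simpa [g, prodForm_apply] using hx y y.2
  obtain ⟨v, hvQ, hvP, hv⟩ := exists_mem_orthogonal_notMem hBM hQ (by
    rw [LinearMap.finrank_range_of_inj hf, LinearMap.finrank_range_of_inj hg]
    omega)
  have hv2 : v.2 ∈ L := by
    rw [← hL]
    intro y hy
    simpa [f, prodForm_apply] using hvP _ ⟨⟨y, hy⟩, rfl⟩
  -- If `v.1` vanished, `v` would lie in `P`. Both `v` and `v.2` are isotropic, the latter because
  -- `v.2 ∈ L`, so `v.1` is isotropic too.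
  refine ⟨v.1, fun h1 => hv ⟨⟨v.2, hv2⟩, Prod.ext h1.symm rfl⟩, ?_⟩
  have h1 : prodForm B M v v = 0 := hQ hvQ v hvQ
  have h2 : M v.2 v.2 = 0 := by
    rw [← hL] at hv2
    exact hv2 _ (hL ▸ hv2)
  rwa [prodForm_apply, h2, add_zero] at h1

theorem injective_of_nondegenerate {B : BilinForm k V} {C : BilinForm k W} (hB : B.Nondegenerate)
    (f : V →ₗ[k] W) (hf : ∀ x y, C (f x) (f y) = B x y) : Function.Injective f :=
  fun x y hxy => sub_eq_zero.1 (hB.1 _ fun z => by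
    rw [← hf, map_sub, hxy, sub_self, map_zero, LinearMap.zero_apply])

theorem equivalent_of_finrank_eq {B : BilinForm k V} {C : BilinForm k W} (hB : B.Nondegenerate)
    (hdim : Module.finrank k V = Module.finrank k W) (f : V →ₗ[k] W)
    (hf : ∀ x y, C (f x) (f y) = B x y) : B.Equivalent C :=
  equivalent_of_equiv (LinearMap.linearEquivOfInjective f (injective_of_nondegenerate hB f hf) hdim)
    hf

/-- A nondegenerate form which embeds into another one splits off as an orthogonal summand. -/
theorem exists_equivalent_prodForm_orthogonal {B : BilinForm k V} {C : BilinForm k W}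
    (hB : B.Nondegenerate) (hCs : C.IsSymm) (hC : C.Nondegenerate) (f : V →ₗ[k] W)
    (hf : ∀ x y, C (f x) (f y) = B x y) :
    ∃ P : Submodule k W, (C.restrict P).IsSymm ∧ (C.restrict P).Nondegenerate ∧
      (prodForm B (C.restrict P)).Equivalent C := by
  let P := C.orthogonal (LinearMap.range f)
  have hfP (x : V) (z : P) : C (f x) z = 0 := z.2 _ ⟨x, rfl⟩
  have hPf (x : V) (z : P) : C z (f x) = 0 := by rw [hCs.eq]; exact hfP x z
  have hinj := injective_of_nondegenerate hB f hf
  let g : V × P →ₗ[k] W := f.coprod P.subtype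
  have hg (x y : V × P) : C (g x) (g y) = prodForm B (C.restrict P) x y := by
    rw [prodForm_apply, BilinForm.restrict_apply]
    simp [g, hf, hfP, hPf]
  have hginj : Function.Injective g := by
    refine (injective_iff_map_eq_zero g).2 fun x hx => ?_
    have h1 : x.1 = 0 := hB.1 _ fun y => by
      have := hg x (y, 0)
      rw [hx, map_zero, LinearMap.zero_apply, prodForm_apply, map_zero, add_zero] at this
      exact this.symm
    have h2 : f x.1 + x.2 = 0 := hx
    rw [h1, map_zero, zero_add] at h2
    exact Prod.ext h1 (Subtype.ext h2)
  have hdim : Module.finrank k (V × P) = Module.finrank k W := by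
    have h1 := Submodule.finrank_le (LinearMap.range f)
    rw [Module.finrank_prod, BilinForm.finrank_orthogonal hC, LinearMap.finrank_range_of_inj hinj]
    rw [LinearMap.finrank_range_of_inj hinj] at h1
    omega
  let e := LinearMap.linearEquivOfInjective g hginj hdim
  have hPs : (C.restrict P).IsSymm := ⟨fun x y => hCs.eq _ _⟩
  refine ⟨P, hPs, nondegenerate_of_left hPs fun z hz => ?_, equivalent_of_equiv e hg⟩
  -- A vector of `P` orthogonal to `P` is also orthogonal to the image of `f`, and the two together
  -- span `W`.
  refine Subtype.ext (hC.1 _ fun w => ?_)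
  obtain ⟨x, rfl⟩ := e.surjective w
  have h1 : e x = f x.1 + x.2 := rfl
  rw [h1, map_add, hPf, zero_add]
  exact hz x.2

end Forms

/-! ### Dimension, and isotropic vectors from Witt equivalence -/

namespace BilinearSpace

variable {k : Type u} [Field k]

/-- The dimension of a bilinear space. -/
noncomputable def dim (X : BilinearSpace k) : ℕ := Module.finrank k X.carrier

theorem Isometric.dim_eq {X Y : BilinearSpace k} (h : X.Isometric Y) : X.dim = Y.dim := by
  obtain ⟨e, -⟩ := exists_equiv_of_equivalent h
  exact e.finrank_eq

theorem dim_oplus (X Y : BilinearSpace k) : (X.oplus Y).dim = X.dim + Y.dim :=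
  Module.finrank_prod (M := X.carrier) (M' := Y.carrier)

theorem dim_zero : (zero k).dim = 0 := Module.finrank_zero_of_subsingleton (M := PUnit.{u + 1})

theorem IsMetabolic.even_dim {X : BilinearSpace k} : X.IsMetabolic → Even X.dim := by
  rintro ⟨L, hL⟩
  exact ⟨_, (finrank_eq_two_mul_of_orthogonal_eq X.nondegenerate hL).trans (two_mul _)⟩

theorem WittEquiv.even_dim_iff {X Y : BilinearSpace k} :
    X.WittEquiv Y → (Even X.dim ↔ Even Y.dim) := by
  rintro ⟨M, N, hM, hN, h⟩
  have h1 := h.dim_eq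
  rw [dim_oplus, dim_oplus] at h1
  have h2 := hM.even_dim
  have h3 := hN.even_dim
  rw [Nat.even_iff] at h2 h3 ⊢
  rw [Nat.even_iff]
  omega

/-- A bilinear space which is Witt equivalent to a space of smaller dimension is isotropic. -/
theorem WittEquiv.exists_isotropic {X Y : BilinearSpace k} (hlt : Y.dim < X.dim) :
    X.WittEquiv Y → ∃ v : X.carrier, v ≠ 0 ∧ X.form v v = 0 := by
  rintro ⟨M, N, hM, hN, h⟩
  exact exists_isotropic_of_equivalent (X.oplus M).nondegenerate M.nondegenerate N.nondegenerate
    hM hN h hlt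

theorem exists_prodForm_equivalent (X : BilinearSpace k) {V : Type u} [AddCommGroup V] [Module k V]
    [FiniteDimensional k V] {B : BilinForm k V} (hB : B.Nondegenerate) (f : V →ₗ[k] X.carrier)
    (hf : ∀ x y, X.form (f x) (f y) = B x y) :
    ∃ Z : BilinearSpace k, (prodForm B Z.form).Equivalent X.form := by
  obtain ⟨P, hPs, hP, h⟩ := exists_equivalent_prodForm_orthogonal hB X.isSymm X.nondegenerate f hf
  exact ⟨⟨P, X.form.restrict P, hPs, hP⟩, h⟩

/-! ### Lines, metabolic planes and diagonal spaces -/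

/-- The form `(x, y) ↦ a x y` on `k`. -/
def lineForm (a : kˣ) : BilinForm k k := (a : k) • LinearMap.mul k k

theorem lineForm_apply (a : kˣ) (x y : k) : lineForm a x y = a * (x * y) := rfl

theorem isSymm_lineForm (a : kˣ) : (lineForm a).IsSymm :=
  ⟨fun x y => by rw [lineForm_apply, lineForm_apply, mul_comm x]⟩

theorem nondegenerate_lineForm (a : kˣ) : (lineForm a).Nondegenerate :=
  nondegenerate_of_left (isSymm_lineForm a) fun x h => by simpa [lineForm_apply] using h 1

/-- The one-dimensional space `⟨a⟩`. -/
def line (a : kˣ) : BilinearSpace k where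
  carrier := k
  form := lineForm a
  isSymm := isSymm_lineForm a
  nondegenerate := nondegenerate_lineForm a

theorem dim_line (a : kˣ) : (line a).dim = 1 := Module.finrank_self k

/-- The form on `k × k` with Gram matrix `(0, 1; 1, c)`. -/
def planeForm (c : k) : BilinForm k (k × k) :=
  LinearMap.mk₂ k (fun x y => x.1 * y.2 + x.2 * y.1 + c * (x.2 * y.2))
    (fun x x' y => by simp; ring) (fun a x y => by simp; ring)
    (fun x y y' => by simp; ring) (fun a x y => by simp; ring)

theorem planeForm_apply (c : k) (x y : k × k) :
    planeForm c x y = x.1 * y.2 + x.2 * y.1 + c * (x.2 * y.2) := rfl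

theorem isSymm_planeForm (c : k) : (planeForm c).IsSymm :=
  ⟨fun x y => by rw [planeForm_apply, planeForm_apply]; ring⟩

theorem nondegenerate_planeForm (c : k) : (planeForm c).Nondegenerate :=
  nondegenerate_of_left (isSymm_planeForm c) fun x h => by
    have h1 : x.2 = 0 := by simpa [planeForm_apply] using h (1, 0)
    have h2 : x.1 = 0 := by simpa [planeForm_apply, h1] using h (0, 1)
    exact Prod.ext h2 h1

theorem isMetabolicForm_planeForm (c : k) : IsMetabolicForm (planeForm c) := by
  refine ⟨LinearMap.ker (LinearMap.snd k k k), ?_⟩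
  ext y
  rw [mem_orthogonal, LinearMap.mem_ker, LinearMap.snd_apply]
  constructor
  · intro h
    simpa [planeForm_apply] using h (1, 0) rfl
  · intro hy x hx
    have hx : x.2 = 0 := hx
    simp [planeForm_apply, hx, hy]

/-- The plane with Gram matrix `(0, 1; 1, c)`. -/
def metabolicPlane (c : k) : BilinearSpace k where
  carrier := k × k
  form := planeForm c
  isSymm := isSymm_planeForm c
  nondegenerate := nondegenerate_planeForm c

theorem dim_metabolicPlane (c : k) : (metabolicPlane c).dim = 2 :=
  (Module.finrank_prod (M := k) (M' := k)).trans (by simp)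

theorem isMetabolic_metabolicPlane (c : k) : (metabolicPlane c).IsMetabolic :=
  isMetabolicForm_planeForm c

theorem exists_line_oplus_isometric (X : BilinearSpace k) (v : X.carrier) (a : kˣ)
    (hv : X.form v v = a) : ∃ Z : BilinearSpace k, ((line a).oplus Z).Isometric X := by
  have h := X.exists_prodForm_equivalent (nondegenerate_lineForm a)
    (LinearMap.toSpanSingleton k X.carrier v) fun x y => by
      simp only [lineForm_apply, LinearMap.toSpanSingleton_apply, map_smul, LinearMap.smul_apply,
        hv, smul_eq_mul]
      ring
  exact h

/-- Pair `v` with some `w` to the value `1`; then `(v, w)` has Gram matrix `(0, 1; 1, c)` with `c =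
X.form w w`. Replacing `w` by `w + λ v` changes `c` by `2λ`, so `c` cannot be normalised to `0` in
characteristic 2 and remains a parameter. -/
theorem exists_metabolicPlane_oplus_isometric (X : BilinearSpace k) (v : X.carrier) (hv : v ≠ 0)
    (hv' : X.form v v = 0) :
    ∃ (c : k) (Z : BilinearSpace k), ((metabolicPlane c).oplus Z).Isometric X := by
  obtain ⟨w, hw⟩ : ∃ w, X.form v w ≠ 0 := by
    by_contra! h
    exact hv (X.nondegenerate.1 v h)
  obtain ⟨w, hw⟩ : ∃ w, X.form v w = 1 :=
    ⟨(X.form v w)⁻¹ • w, by rw [map_smul, smul_eq_mul, inv_mul_cancel₀ hw]⟩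
  have hw' : X.form w v = 1 := by rw [X.isSymm.eq, hw]
  have h := X.exists_prodForm_equivalent (nondegenerate_planeForm (X.form w w))
    ((LinearMap.toSpanSingleton k X.carrier v).coprod (LinearMap.toSpanSingleton k X.carrier w))
    fun x y => by
      simp only [planeForm_apply, LinearMap.coprod_apply, LinearMap.toSpanSingleton_apply, map_add,
        map_smul, LinearMap.add_apply, LinearMap.smul_apply, hv', hw, hw', smul_eq_mul]
      ring
  exact ⟨_, h⟩

/-- The space `⟨a₁, …, aₙ⟩`, as an iterated orthogonal sum. -/
def lines : List kˣ → BilinearSpace k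
  | [] => zero k
  | a :: l => (line a).oplus (lines l)

theorem dim_lines (l : List kˣ) : (lines l).dim = l.length := by
  induction l with
  | nil => exact dim_zero
  | cons a l ih => rw [lines, dim_oplus, dim_line, ih, List.length_cons, add_comm]

theorem isometric_zero_of_dim_eq_zero {X : BilinearSpace k} (h : X.dim = 0) :
    X.Isometric (zero k) := by
  have : Subsingleton X.carrier := Module.finrank_zero_iff.1 h
  exact equivalent_of_equiv (B := X.form) (C := (0 : BilinForm k PUnit.{u + 1}))
    (LinearEquiv.ofFinrankEq X.carrier PUnit.{u + 1} (h.trans dim_zero.symm)) fun x y => by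
      rw [Subsingleton.elim x 0, map_zero, map_zero]
      rfl

end BilinearSpace

/-! ### One-dimensional classes and their relations in `W(k)` -/

namespace BilinearWittRing

open BilinearSpace

variable {k : Type u} [Field k]

theorem mk_of_isMetabolic {X : BilinearSpace k} (h : X.IsMetabolic) : mk X = 0 :=
  mk_eq_mk_iff.2 h.wittEquiv_zero

/-- The class of the one-dimensional form `⟨a⟩`. -/
def rankOne (a : kˣ) : BilinearWittRing k := mk (line a)

theorem mk_lines_cons (a : kˣ) (l : List kˣ) : mk (lines (a :: l)) = rankOne a + mk (lines l) := rfl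

theorem mk_lines (l : List kˣ) : mk (lines l) = (l.map rankOne).sum := by
  induction l with
  | nil => rfl
  | cons a l ih => rw [mk_lines_cons, ih, List.map_cons, List.sum_cons]

theorem rankOne_one : rankOne (1 : kˣ) = 1 :=
  mk_of_isometric (equivalent_of_equiv (B := lineForm (1 : kˣ)) (C := LinearMap.mul k k)
    (LinearEquiv.refl k k) fun x y => (one_mul (x * y)).symm)

theorem rankOne_mul (a b : kˣ) : rankOne (a * b) = rankOne a * rankOne b := by
  have h : (tensorForm (lineForm a) (lineForm b)).Equivalent (lineForm (a * b)) :=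
    tensorForm_equivalent_of_equiv (TensorProduct.lid k k) fun v w v' w' => by
      simp only [TensorProduct.lid_tmul, lineForm_apply, smul_eq_mul, Units.val_mul]
      ring
  exact (mk_of_isometric (X := (line a).tensor (line b)) (Y := line (a * b)) h).symm

theorem rankOne_neg (a : kˣ) : rankOne (-a) = -rankOne a :=
  mk_of_isometric (Y := (line a).neg) (equivalent_of_equiv (B := lineForm (-a))
    (C := -lineForm a) (LinearEquiv.refl k k) fun x y => (neg_mul (a : k) (x * y)).symm)

theorem rankOne_mul_sq (a u : kˣ) : rankOne (a * u ^ 2) = rankOne a := by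
  have h : (lineForm (a * u ^ 2)).Equivalent (lineForm a) :=
    equivalent_of_equiv (LinearEquiv.smulOfUnit u) fun x y => by
      change (a : k) * ((u * x) * (u * y)) = (a * u ^ 2 : kˣ) * (x * y)
      push_cast
      ring
  exact mk_of_isometric (X := line (a * u ^ 2)) (Y := line a) h

/-- Every bilinear space is Witt equivalent to a diagonal space of the same dimension. -/
theorem exists_mk_eq_mk_lines (X : BilinearSpace k) :
    ∃ l : List kˣ, l.length = X.dim ∧ mk X = mk (lines l) := by
  induction h : X.dim using Nat.strong_induction_on generalizing X with
  | _ n ih =>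
    subst h
    by_cases hdim : X.dim = 0
    · exact ⟨[], hdim.symm, mk_of_isometric (isometric_zero_of_dim_eq_zero hdim)⟩
    have : Nontrivial X.carrier := Module.finrank_pos_iff.1 (Nat.pos_of_ne_zero hdim)
    obtain ⟨v, hv⟩ := exists_ne (0 : X.carrier)
    by_cases hvv : X.form v v = 0
    · obtain ⟨c, Z, hZ⟩ := exists_metabolicPlane_oplus_isometric X v hv hvv
      have hd := hZ.dim_eq
      rw [dim_oplus, dim_metabolicPlane] at hd
      obtain ⟨l, hl, h⟩ := ih Z.dim (by omega) Z rfl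
      -- The metabolic plane is traded for `⟨1, -1⟩`, of the same dimension and the same class `0`.
      -- An isometric diagonalisation may not exist: alternating forms in characteristic 2 have
      -- none.
      refine ⟨1 :: -1 :: l, by simp only [List.length_cons]; omega, ?_⟩
      rw [← mk_of_isometric hZ, ← mk_add, mk_of_isMetabolic (isMetabolic_metabolicPlane c), h,
        mk_lines_cons, mk_lines_cons, rankOne_neg]
      abel
    · obtain ⟨Z, hZ⟩ := exists_line_oplus_isometric X v (Units.mk0 _ hvv) rfl
      have hd := hZ.dim_eq
      rw [dim_oplus, dim_line] at hd
      obtain ⟨l, hl, h⟩ := ih Z.dim (by omega) Z rfl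
      refine ⟨Units.mk0 _ hvv :: l, by simp only [List.length_cons]; omega, ?_⟩
      rw [← mk_of_isometric hZ, ← mk_add, h]
      rfl

theorem mk_diagonal {n : ℕ} (a : Fin n → kˣ) : mk (diagonal a) = mk (lines (List.ofFn a)) := by
  induction n with
  | zero =>
    exact mk_of_isometric (isometric_zero_of_dim_eq_zero
      (Module.finrank_zero_of_subsingleton (M := Fin 0 → k)))
  | succ n ih =>
    rw [List.ofFn_succ, mk_lines_cons, ← ih, rankOne, mk_add]
    have h : (prodForm (lineForm (a 0)) (diagonalForm fun i => a i.succ)).Equivalent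
        (diagonalForm a) :=
      equivalent_of_equiv (Fin.consLinearEquiv k fun _ => k) fun x y => by
        rw [diagonalForm_apply, Fin.sum_univ_succ, prodForm_apply, diagonalForm_apply]
        rfl
    exact (mk_of_isometric (X := (line (a 0)).oplus (diagonal fun i => a i.succ))
      (Y := diagonal a) h).symm

/-- If `⟨a, b⟩` takes the value `c`, it splits as `⟨c, abc⟩` by comparing discriminants. The other
elements `c` of the hypersum appear only when `⟨a, b⟩` is isotropic, where both sides vanish in
`W(k)`. -/
theorem rankOne_add_rankOne {a b c : kˣ} (h : QuadraticHyperfield.mk (c : k) ∈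
    hsum (QuadraticHyperfield.mk (a : k)) (QuadraticHyperfield.mk (b : k))) :
    rankOne a + rankOne b = rankOne c + rankOne (a * b * c) := by
  rw [QuadraticHyperfield.mk_mem_hsum_iff c.ne_zero a.ne_zero b.ne_zero] at h
  obtain ⟨p, q, r, hne, h⟩ := h
  by_cases hp : p = 0
  -- Here `b` is `-a` and `abc` is `-c` up to squares. The two binary forms need not be isometric
  -- over `k`, but both have class zero.
  · subst hp
    have hr : r ≠ 0 := by
      rintro rfl
      simp_all
    have hq : q ≠ 0 := by
      rintro rfl
      simp_all
    have hab : b = -a * (Units.mk0 q hq / Units.mk0 r hr) ^ 2 := by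
      ext
      push_cast
      simp only [Units.val_mk0]
      field_simp
      linear_combination -h
    have habc : a * b * c = -c * (a * (Units.mk0 q hq / Units.mk0 r hr)) ^ 2 := by
      rw [hab]
      ext
      push_cast
      ring
    rw [habc, hab, rankOne_mul_sq, rankOne_mul_sq, rankOne_neg, rankOne_neg]
    abel
  -- The basis vectors go to `(q/p, r/p)`, of value `c`, and to the orthogonal vector `(-b r/p, a
  -- q/p)`, of value `abc`.
  · let f : k × k →ₗ[k] k × k := LinearMap.prod
      ((q / p) • LinearMap.fst k k k - (b * (r / p)) • LinearMap.snd k k k)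
      ((r / p) • LinearMap.fst k k k + (a * (q / p)) • LinearMap.snd k k k)
    have h1 : (prodForm (lineForm c) (lineForm (a * b * c))).Equivalent
        (prodForm (lineForm a) (lineForm b)) := by
      refine equivalent_of_finrank_eq ((line c).oplus (line (a * b * c))).nondegenerate rfl f
        fun x y => ?_
      have hc : (c : k) = a * (q / p) ^ 2 + b * (r / p) ^ 2 := by
        field_simp
        linear_combination h
      have hf (x : k × k) : f x =
        (q / p * x.1 - b * (r / p) * x.2, r / p * x.1 + a * (q / p) * x.2) := rfl
      simp only [hf, prodForm_apply, lineForm_apply, Units.val_mul, hc]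
      ring
    exact (mk_of_isometric (X := (line c).oplus (line (a * b * c)))
      (Y := (line a).oplus (line b)) h1).symm

/-- One-dimensional forms are Witt equivalent if and only if they have the same square class. -/
theorem rankOne_eq_rankOne_iff {a b : kˣ} :
    rankOne a = rankOne b ↔ QuadraticHyperfield.mk (a : k) = QuadraticHyperfield.mk (b : k) := by
  constructor
  · intro h
    -- A plane of class zero has larger dimension than the zero space, hence an isotropic vector: `a
    -- v₁² = b v₂²`.
    have h1 : mk ((line a).oplus (line (-b))) = mk (zero k) := by
      rw [← mk_add]
      change rankOne a + rankOne (-b) = 0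
      rw [rankOne_neg, h, add_neg_cancel]
    obtain ⟨v, hv, hv'⟩ : ∃ v : k × k, v ≠ 0 ∧ prodForm (lineForm a) (lineForm (-b)) v v = 0 :=
      (mk_eq_mk_iff.1 h1).exists_isotropic (by
        rw [dim_zero, dim_oplus, dim_line]
        omega)
    rw [prodForm_apply, lineForm_apply, lineForm_apply, Units.val_neg] at hv'
    have hv1 : v.1 ≠ 0 := fun h0 => by
      have : v.2 = 0 := by simpa [h0] using hv'
      exact hv (Prod.ext h0 this)
    have hv2 : v.2 ≠ 0 := fun h0 => by simp [h0, hv1] at hv'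
    refine QuadraticHyperfield.mk_eq_mk_iff.2 ⟨v.2 / v.1, div_ne_zero hv2 hv1, ?_⟩
    field_simp
    linear_combination hv'
  · intro h
    obtain ⟨u, hu, h⟩ := QuadraticHyperfield.mk_eq_mk_iff.1 h
    have : a = b * Units.mk0 u hu ^ 2 := Units.ext (by simpa using h)
    rw [this, rankOne_mul_sq]

end BilinearWittRing

end PresentableWitt

namespace PresentableWitt

/-! ### Isometry of forms over the quadratic hyperfield and Witt classes -/

namespace QuadraticHyperfield

open BilinearSpace BilinearWittRing

variable {k : Type u} [Field k]

/-! ### Non-zero supercompacts as square classes -/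

theorem supercompact_surjective : Function.Surjective (supercompact (k := k)) := by
  rintro ⟨A, hA, hA0⟩
  obtain ⟨x, rfl⟩ := PiercedPowerset.isMin_iff.1 hA
  obtain ⟨x, rfl⟩ := mk_surjective x
  have hx : x ≠ 0 := by
    rintro rfl
    exact hA0 rfl
  exact ⟨Units.mk0 x hx, rfl⟩

theorem supercompact_eq_iff {a b : kˣ} : supercompact a = supercompact b ↔ mk (a : k) = mk (b : k) :=
  Subtype.ext_iff.trans PiercedPowerset.singleton_injective.eq_iff

theorem val_supercompact_eq_iff {a b : kˣ} :
    (supercompact a).1 = (supercompact b).1 ↔ mk (a : k) = mk (b : k) :=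
  PiercedPowerset.singleton_injective.eq_iff

theorem val_supercompact_mul (a b : kˣ) :
    (supercompact a).1 * (supercompact b).1 = (supercompact (a * b)).1 :=
  PiercedPowerset.singleton_mul _ _

theorem supercompact_le_add_iff {a b c : kˣ} :
    (supercompact a).1 ≤ (supercompact b).1 + (supercompact c).1 ↔
      mk (a : k) ∈ hsum (mk (b : k)) (mk (c : k)) :=
  PiercedPowerset.singleton_le_add_iff

/-- Square classes satisfy `c * c = 1`, so equality of discriminants forces the class of `d` to be
that of `abc`. -/
theorem rankOne_add_rankOne_eq {a b c d : kˣ}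
    (h : mk ((a * b : kˣ) : k) = mk ((c * d : kˣ) : k))
    (h' : mk (c : k) ∈ hsum (mk (a : k)) (mk (b : k))) :
    rankOne a + rankOne b = rankOne c + rankOne d := by
  rw [rankOne_add_rankOne h']
  congr 1
  rw [rankOne_eq_rankOne_iff]
  have hc : mk (c : k) * mk (c : k) = 1 := mul_self fun h => c.ne_zero (mk_eq_zero_iff.1 h)
  calc mk ((a * b * c : kˣ) : k) = mk ((a * b : kˣ) : k) * mk (c : k) := by
        rw [← mk_mul, Units.val_mul]
    _ = mk (c : k) * mk (c : k) * mk (d : k) := by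
        rw [h, ← mk_mul, ← mk_mul, ← mk_mul, Units.val_mul, mul_right_comm]
    _ = mk (d : k) := by rw [hc, (isHyperfield k).one_mul]

/-- The Witt class of the one-dimensional form given by a nonzero supercompact. -/
noncomputable def wittClassOne (s : NonzeroSupercompact (PiercedPowerset (QuadraticHyperfield k))) :
    BilinearWittRing k := rankOne (Function.surjInv supercompact_surjective s)

/-- The representative chosen by `Function.surjInv` is immaterial, since `rankOne` depends only on
the square class. -/
theorem wittClassOne_supercompact (a : kˣ) : wittClassOne (supercompact a) = rankOne a :=
  rankOne_eq_rankOne_iff.2 (supercompact_eq_iff.1 (Function.surjInv_eq _ _))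

/-- The class in `W(k)` of a form over the pierced powerset of `Q(k)`. -/
noncomputable def wittClass (φ : Form (PiercedPowerset (QuadraticHyperfield k))) :
    BilinearWittRing k := (φ.map wittClassOne).sum

theorem wittClass_nil : wittClass ([] : Form (PiercedPowerset (QuadraticHyperfield k))) = 0 := rfl

theorem wittClass_cons (s : NonzeroSupercompact (PiercedPowerset (QuadraticHyperfield k)))
    (φ : Form (PiercedPowerset (QuadraticHyperfield k))) :
    wittClass (s :: φ) = wittClassOne s + wittClass φ := rfl

theorem wittClass_append (φ ψ : Form (PiercedPowerset (QuadraticHyperfield k))) :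
    wittClass (φ ++ ψ) = wittClass φ + wittClass ψ := by
  rw [wittClass, List.map_append, List.sum_append, wittClass, wittClass]

theorem wittClass_map_supercompact (l : List kˣ) :
    wittClass (l.map supercompact) = BilinearWittRing.mk (lines l) := by
  rw [mk_lines, wittClass, List.map_map]
  congr 2
  exact funext wittClassOne_supercompact

/-! ### Isometry is classified by dimension and Witt class -/

/-- Isometric forms have the same Witt class. -/
theorem wittClass_eq_of_formIsometry {φ ψ : Form (PiercedPowerset (QuadraticHyperfield k))}
    (h : FormIsometry φ ψ) : wittClass φ = wittClass ψ := by
  induction h with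
  | nil => rfl
  | unary a => rfl
  | binary a b c d disc le =>
    obtain ⟨a, rfl⟩ := supercompact_surjective a
    obtain ⟨b, rfl⟩ := supercompact_surjective b
    obtain ⟨c, rfl⟩ := supercompact_surjective c
    obtain ⟨d, rfl⟩ := supercompact_surjective d
    rw [val_supercompact_mul, val_supercompact_mul, val_supercompact_eq_iff] at disc
    simpa only [wittClass_cons, wittClass_nil, add_zero, wittClassOne_supercompact] using
      rankOne_add_rankOne_eq disc (supercompact_le_add_iff.1 le)
  | step a b x y φ ψ χ hχ h₁ h₂ h₃ ih₁ ih₂ ih₃ =>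
    simp only [wittClass_cons, wittClass_nil, add_zero] at ih₁ ih₂ ih₃ ⊢
    -- In `W(k)`: `a + φ = a + x + χ = b + y + χ = b + ψ`.
    linear_combination ih₁ + ih₂ - ih₃

/-- `Form.iso_length` presupposes quadratic presentability, which this lemma helps to establish. -/
theorem length_eq_of_formIsometry {φ ψ : Form (PiercedPowerset (QuadraticHyperfield k))}
    (h : FormIsometry φ ψ) : φ.length = ψ.length := by
  induction h with
  | nil => rfl
  | unary => rfl
  | binary => rfl
  | step a₁ b₁ x y a b c hc h₁ h₂ h₃ _ h₂' h₃' => simp_all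

theorem formIsometry_pair {a b c : kˣ} (h : mk (c : k) ∈ hsum (mk (a : k)) (mk (b : k))) :
    FormIsometry [supercompact a, supercompact b] [supercompact c, supercompact (a * b * c)] := by
  refine .binary _ _ _ _ ?_ (supercompact_le_add_iff.2 h)
  rw [val_supercompact_mul, val_supercompact_mul, val_supercompact_eq_iff,
    mk_eq_mk_iff]
  refine ⟨(c : k)⁻¹, inv_ne_zero c.ne_zero, ?_⟩
  have := c.ne_zero
  push_cast
  field_simp

/-- The inductive step for comparing forms of the same dimension and Witt class: a common
subform of codimension two. -/
theorem exists_common_subform {a b : kˣ} {l m : List kˣ} (hl : 2 ≤ l.length)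
    (hm : m.length ≤ l.length)
    (h : BilinearWittRing.mk (lines (a :: l)) = BilinearWittRing.mk (lines (b :: m))) :
    ∃ (x : kˣ) (c : List kˣ), c.length + 1 = l.length ∧
      BilinearWittRing.mk (lines l) = BilinearWittRing.mk (lines (x :: c)) ∧
      mk (b : k) ∈ hsum (mk (a : k)) (mk (x : k)) := by
  -- Moving `b` across makes the left side longer than the right by at least two, hence isotropic:
  -- `-b s² + a t² + l(w) = 0` for some non-zero `(s, t, w)`.
  have h1 : BilinearWittRing.mk (lines (-b :: a :: l)) = BilinearWittRing.mk (lines m) := by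
    rw [mk_lines_cons, h, mk_lines_cons, rankOne_neg, neg_add_cancel_left]
  obtain ⟨v, hv, hv'⟩ : ∃ v : k × k × (lines l).carrier, v ≠ 0 ∧
      prodForm (lineForm (-b)) (prodForm (lineForm a) (lines l).form) v v = 0 :=
    (BilinearWittRing.mk_eq_mk_iff.1 h1).exists_isotropic (by
      simp only [dim_lines, List.length_cons]
      omega)
  obtain ⟨s, t, w⟩ := v
  simp only [prodForm_apply, lineForm_apply, Units.val_neg] at hv'
  by_cases hw : (lines l).form w w = 0
  · by_cases hw0 : w = 0
    -- With `w = 0`, the zero `(s, t)` of `⟨-b, a⟩` already puts `b` in the sum of `a` and any `x`,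
    -- so `l` is left as it is.
    · obtain ⟨x, c, rfl⟩ : ∃ x c, l = x :: c := List.exists_cons_of_length_pos (by omega)
      refine ⟨x, c, rfl, rfl, (mk_mem_hsum_iff b.ne_zero a.ne_zero x.ne_zero).2
        ⟨s, t, 0, fun H => hv ?_, by linear_combination hw - hv'⟩⟩
      rw [H.1, H.2.1, hw0]
      rfl
    -- The metabolic plane split off from `l` has the class of `⟨-a, a⟩`. With `x = -a` the sum of
    -- `a` and `x` is everything, so it contains `b`.
    · obtain ⟨d, Z, hZ⟩ := exists_metabolicPlane_oplus_isometric _ w hw0 hw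
      obtain ⟨c, hc, hc'⟩ := exists_mk_eq_mk_lines Z
      have hd := hZ.dim_eq
      rw [dim_oplus, dim_metabolicPlane, dim_lines] at hd
      refine ⟨-a, a :: c, by rw [List.length_cons]; omega, ?_,
        (mk_mem_hsum_iff b.ne_zero a.ne_zero (-a).ne_zero).2 ⟨0, 1, 1, by simp, by simp⟩⟩
      rw [← mk_of_isometric hZ, ← mk_add, mk_of_isMetabolic (isMetabolic_metabolicPlane d), hc',
        mk_lines_cons, mk_lines_cons, rankOne_neg, neg_add_cancel_left, zero_add]
  -- Take for `x` the non-zero value of `l` at `w`; the isotropy relation says that `b` lies in the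
  -- sum of `a` and `x`.
  · obtain ⟨Z, hZ⟩ := exists_line_oplus_isometric _ w (Units.mk0 _ hw) rfl
    obtain ⟨c, hc, hc'⟩ := exists_mk_eq_mk_lines Z
    have hd := hZ.dim_eq
    rw [dim_oplus, dim_line, dim_lines] at hd
    refine ⟨Units.mk0 _ hw, c, by omega, ?_,
      (mk_mem_hsum_iff b.ne_zero a.ne_zero hw).2 ⟨s, t, 1, by simp, by linear_combination -hv'⟩⟩
    rw [← mk_of_isometric hZ, ← mk_add, hc']
    rfl

/-- This is the converse of `wittClass_eq_of_formIsometry`, by induction on the length. Equality of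
Witt classes only has to produce a first entry of an isometric binary form; the remaining entries
are governed by cancellation in the additive group of `W(k)`. -/
theorem formIsometry_map_supercompact {l m : List kˣ} (hlen : l.length = m.length)
    (h : BilinearWittRing.mk (lines l) = BilinearWittRing.mk (lines m)) :
    FormIsometry (l.map supercompact) (m.map supercompact) := by
  induction hn : l.length generalizing l m with
  | zero =>
    rw [List.length_eq_zero_iff.1 hn, List.length_eq_zero_iff.1 (hlen.symm.trans hn)]
    exact .nil
  | succ n ih =>
    obtain ⟨a, l, rfl⟩ := List.exists_cons_of_length_eq_add_one hn
    obtain ⟨b, m, rfl⟩ := List.exists_cons_of_length_eq_add_one (hlen.symm.trans hn)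
    simp only [List.length_cons, Nat.add_right_cancel_iff] at hlen hn
    rcases l with _ | ⟨a', _ | ⟨a'', l⟩⟩
    · rw [List.length_eq_zero_iff.1 hlen.symm] at h ⊢
      have h1 : rankOne a = rankOne b := by
        simpa only [mk_lines_cons, add_left_inj] using h
      rw [List.map_cons, List.map_cons, supercompact_eq_iff.2 (rankOne_eq_rankOne_iff.1 h1)]
      exact .unary _
    · obtain ⟨b', rfl⟩ := List.length_eq_one_iff.1 hlen.symm
      -- The ternary `⟨-b, a, a'⟩` has the class of the unary `⟨b'⟩`, so it is isotropic and `b`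
      -- lies in the sum of `a` and `a'`. The discriminant relation then identifies `b'`.
      have h1 : BilinearWittRing.mk (lines (-b :: [a, a'])) = BilinearWittRing.mk (lines [b']) := by
        rw [mk_lines_cons, h, mk_lines_cons, rankOne_neg, neg_add_cancel_left]
      obtain ⟨v, hv, hv'⟩ : ∃ v : k × k × k × PUnit.{u + 1}, v ≠ 0 ∧
          prodForm (lineForm (-b)) (prodForm (lineForm a) (prodForm (lineForm a') 0)) v v = 0 :=
        (BilinearWittRing.mk_eq_mk_iff.1 h1).exists_isotropic (by simp [dim_lines])
      simp only [prodForm_apply, lineForm_apply, Units.val_neg, LinearMap.zero_apply] at hv'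
      have hb : mk (b : k) ∈ hsum (mk (a : k)) (mk (a' : k)) :=
        (mk_mem_hsum_iff b.ne_zero a.ne_zero a'.ne_zero).2 ⟨v.1, v.2.1, v.2.2.1,
          fun H => hv (Prod.ext H.1 (Prod.ext H.2.1 (Prod.ext H.2.2 rfl))),
          by linear_combination -hv'⟩
      have h2 : rankOne (a * a' * b) = rankOne b' := by
        have h3 := rankOne_add_rankOne hb
        simp only [mk_lines_cons] at h
        linear_combination h - h3
      have h4 := formIsometry_pair hb
      rwa [supercompact_eq_iff.2 (rankOne_eq_rankOne_iff.1 h2)] at h4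
    · have hl : 2 ≤ (a' :: a'' :: l).length := by simp
      generalize a' :: a'' :: l = l at *
      -- Here `y = a x b`: the binary relation and cancellation of `b` in `W(k)` show that `m` has
      -- the class of `⟨axb⟩ ⊥ c`, so induction applies to both tails.
      obtain ⟨x, c, hc, hlc, hx⟩ := exists_common_subform hl hlen.ge h
      have hxy := formIsometry_pair hx
      have hmc : BilinearWittRing.mk (lines m) =
          BilinearWittRing.mk (lines (a * x * b :: c)) := by
        have h1 := rankOne_add_rankOne hx
        rw [mk_lines_cons, mk_lines_cons] at h
        rw [mk_lines_cons] at hlc ⊢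
        linear_combination h1 - h + hlc
      refine .step _ _ _ _ _ _ (c.map supercompact) ?_ hxy
        (ih (m := x :: c) (by rw [List.length_cons, hc]) hlc hn)
        (ih (m := a * x * b :: c) (by rw [List.length_cons, hc, hlen]) hmc (hlen.symm.trans hn))
      -- The constructor `step` needs a non-empty `c`; its length is one less than that of `l`,
      -- which is at least 2.
      rw [Ne, List.map_eq_nil_iff, ← List.length_eq_zero_iff]
      omega

/-- Two forms over the pierced powerset of `Q(k)` are isometric if and only if they have the same
dimension and the same class in `W(k)`. -/
theorem formIsometry_iff {φ ψ : Form (PiercedPowerset (QuadraticHyperfield k))} :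
    FormIsometry φ ψ ↔ φ.length = ψ.length ∧ wittClass φ = wittClass ψ := by
  refine ⟨fun h => ⟨length_eq_of_formIsometry h, wittClass_eq_of_formIsometry h⟩, fun ⟨h, h'⟩ => ?_⟩
  obtain ⟨l, rfl⟩ := List.map_surjective_iff.2 supercompact_surjective φ
  obtain ⟨m, rfl⟩ := List.map_surjective_iff.2 supercompact_surjective ψ
  rw [wittClass_map_supercompact, wittClass_map_supercompact] at h'
  rw [List.length_map, List.length_map] at h
  exact formIsometry_map_supercompact h h'

/-- By `formIsometry_iff`, isometry is equality of the pair (length, Witt class). -/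
instance isQuadraticallyPresentable :
    IsQuadraticallyPresentable (PiercedPowerset (QuadraticHyperfield k)) where
  toIsPreQuadraticallyPresentable := isPreQuadraticallyPresentable k
  equivalence_formIsometry :=
    { refl := fun _ => formIsometry_iff.2 ⟨rfl, rfl⟩
      symm := fun h => formIsometry_iff.2 ((formIsometry_iff.1 h).imp Eq.symm Eq.symm)
      trans := fun h h' => formIsometry_iff.2
        ⟨(formIsometry_iff.1 h).1.trans (formIsometry_iff.1 h').1,
          (formIsometry_iff.1 h).2.trans (formIsometry_iff.1 h').2⟩ }

/-! ### The isomorphism of Witt rings -/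

theorem wittClassOne_one :
    wittClassOne (1 : NonzeroSupercompact (PiercedPowerset (QuadraticHyperfield k))) = 1 :=
  (wittClassOne_supercompact 1).trans rankOne_one

theorem supercompact_mul (a b : kˣ) : supercompact a * supercompact b = supercompact (a * b) :=
  Subtype.ext (val_supercompact_mul a b)

theorem supercompact_neg (a : kˣ) : -supercompact a = supercompact (-a) :=
  Subtype.ext (PiercedPowerset.neg_singleton _)

theorem wittClassOne_mul (s t : NonzeroSupercompact (PiercedPowerset (QuadraticHyperfield k))) :
    wittClassOne (s * t) = wittClassOne s * wittClassOne t := by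
  obtain ⟨a, rfl⟩ := supercompact_surjective s
  obtain ⟨b, rfl⟩ := supercompact_surjective t
  simp only [supercompact_mul, wittClassOne_supercompact, rankOne_mul]

theorem wittClassOne_neg (s : NonzeroSupercompact (PiercedPowerset (QuadraticHyperfield k))) :
    wittClassOne (-s) = -wittClassOne s := by
  obtain ⟨a, rfl⟩ := supercompact_surjective s
  simp only [supercompact_neg, wittClassOne_supercompact, rankOne_neg]

theorem wittClass_map_mul (s : NonzeroSupercompact (PiercedPowerset (QuadraticHyperfield k)))
    (φ : Form (PiercedPowerset (QuadraticHyperfield k))) :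
    wittClass (φ.map (s * ·)) = wittClassOne s * wittClass φ := by
  induction φ with
  | nil => exact (mul_zero _).symm
  | cons t φ ih => rw [List.map_cons, wittClass_cons, wittClass_cons, ih, wittClassOne_mul, mul_add]

theorem wittClass_tensor (φ ψ : Form (PiercedPowerset (QuadraticHyperfield k))) :
    wittClass (Form.tensor φ ψ) = wittClass φ * wittClass ψ := by
  induction φ with
  | nil => exact (zero_mul _).symm
  | cons s φ ih =>
    rw [Form.tensor, List.flatMap_cons, wittClass_append, wittClass_map_mul, wittClass_cons,
      add_mul, ← ih, Form.tensor]

theorem wittClass_hyperbolic (n : ℕ) :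
    wittClass (Form.hyperbolic n : Form (PiercedPowerset (QuadraticHyperfield k))) = 0 := by
  induction n with
  | zero => rfl
  | succ n ih =>
    rw [Form.hyperbolic_succ, wittClass_cons, wittClass_cons, ih, wittClassOne_neg, add_zero,
      add_neg_cancel]

theorem length_hyperbolic (n : ℕ) :
    (Form.hyperbolic n : Form (PiercedPowerset (QuadraticHyperfield k))).length = 2 * n := by
  induction n with
  | zero => rfl
  | succ n ih => rw [Form.hyperbolic_succ, List.length_cons, List.length_cons, ih]; ring

/-- Metabolic spaces have even dimension, so the parity of the dimension depends only on the class
in `W(k)`. -/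
theorem even_length_iff_of_wittClass_eq {φ ψ : Form (PiercedPowerset (QuadraticHyperfield k))}
    (h : wittClass φ = wittClass ψ) : Even φ.length ↔ Even ψ.length := by
  obtain ⟨l, rfl⟩ := List.map_surjective_iff.2 supercompact_surjective φ
  obtain ⟨m, rfl⟩ := List.map_surjective_iff.2 supercompact_surjective ψ
  rw [wittClass_map_supercompact, wittClass_map_supercompact] at h
  rw [List.length_map, List.length_map, ← dim_lines, ← dim_lines]
  exact (BilinearWittRing.mk_eq_mk_iff.1 h).even_dim_iff

/-- Witt equivalence of forms over the pierced powerset of `Q(k)` is equality in `W(k)`. -/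
theorem wittEquiv_iff {φ ψ : Form (PiercedPowerset (QuadraticHyperfield k))} :
    Form.WittEquiv φ ψ ↔ wittClass φ = wittClass ψ := by
  constructor
  · rintro ⟨m, n, h⟩
    simpa only [Form.oplus, wittClass_append, wittClass_hyperbolic, add_zero] using
      wittClass_eq_of_formIsometry h
  · intro h
    have hlen := even_length_iff_of_wittClass_eq h
    obtain ⟨m, n, hmn⟩ : ∃ m n, φ.length + 2 * m = ψ.length + 2 * n := by
      -- With `m = ψ.length` the required equation is `2 n = φ.length + ψ.length`; equal parities
      -- make the halving exact.
      refine ⟨ψ.length, (φ.length + ψ.length) / 2, ?_⟩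
      rw [Nat.even_iff, Nat.even_iff] at hlen
      omega
    refine ⟨m, n, formIsometry_iff.2 ⟨?_, ?_⟩⟩
    · simpa only [Form.oplus, List.length_append, length_hyperbolic] using hmn
    · simpa only [Form.oplus, wittClass_append, wittClass_hyperbolic, add_zero] using h

variable (k) in
/-- The ring homomorphism from the Witt ring of the pierced powerset of `Q(k)` to `W(k)`. -/
noncomputable def wittRingHom :
    WittRing (PiercedPowerset (QuadraticHyperfield k)) →+* BilinearWittRing k where
  toFun := Quotient.lift wittClass fun _ _ h => wittEquiv_iff.1 h
  map_one' := (add_zero _).trans wittClassOne_one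
  map_zero' := rfl
  map_mul' x y := by
    induction x using WittRing.ind; induction y using WittRing.ind
    exact wittClass_tensor _ _
  map_add' x y := by
    induction x using WittRing.ind; induction y using WittRing.ind
    exact wittClass_append _ _

theorem wittRingHom_mk (φ : Form (PiercedPowerset (QuadraticHyperfield k))) :
    wittRingHom k (WittRing.mk φ) = wittClass φ := rfl

variable (k) in
theorem wittRingHom_bijective : Function.Bijective (wittRingHom k) := by
  constructor
  · intro x y h
    induction x using WittRing.ind; induction y using WittRing.ind
    exact WittRing.mk_eq_mk_iff.2 (wittEquiv_iff.2 h)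
  · intro x
    induction x using BilinearWittRing.ind with
    | _ X =>
      obtain ⟨l, -, h⟩ := exists_mk_eq_mk_lines X
      exact ⟨WittRing.mk (l.map supercompact), by
        rw [wittRingHom_mk, wittClass_map_supercompact, h]⟩

theorem wittRingHom_mk_ofFn {n : ℕ} (a : Fin n → kˣ) :
    wittRingHom k (WittRing.mk (List.ofFn fun i => supercompact (a i))) =
      BilinearWittRing.mk (diagonal a) := by
  rw [wittRingHom_mk, mk_diagonal, ← wittClass_map_supercompact, List.map_ofFn]
  rfl

end QuadraticHyperfield

end PresentableWitt

theorem mainTheorem1 (k : Type u) [Field k] :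
    PresentableWitt.IsHyperfield (PresentableWitt.QuadraticHyperfield k) ∧
    ∃ _ : PresentableWitt.IsQuadraticallyPresentable
        (PresentableWitt.PiercedPowerset (PresentableWitt.QuadraticHyperfield k)),
      ∃ ω : PresentableWitt.BilinearWittRing k ≃+*
          PresentableWitt.WittRing
            (PresentableWitt.PiercedPowerset (PresentableWitt.QuadraticHyperfield k)),
        ∀ (n : ℕ) (a : Fin n → kˣ),
          ω (PresentableWitt.BilinearWittRing.mk (PresentableWitt.BilinearSpace.diagonal a)) =
            PresentableWitt.WittRing.mk
              (List.ofFn fun i => PresentableWitt.QuadraticHyperfield.supercompact (a i)) := by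
  -- The isomorphism is the inverse of `wittRingHom`: a tuple determines its class in `W(k)`
  -- directly, whereas the opposite direction would start from a choice of diagonal representatives.
  refine ⟨PresentableWitt.QuadraticHyperfield.isHyperfield k, inferInstance,
    (RingEquiv.ofBijective _
      (PresentableWitt.QuadraticHyperfield.wittRingHom_bijective k)).symm, fun n a => ?_⟩
  rw [RingEquiv.symm_apply_eq]
  exact (PresentableWitt.QuadraticHyperfield.wittRingHom_mk_ofFn a).symm
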